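/- Let $d,n\ge 0$ be integers. For $s\in\mathbb{Z}$ let $I_s(2t)=[z^s]\exp\bigl(t(z+z^{-1})\bigr)=\sum_{k\ge \max(0,-s)}\frac{t^{2k+s}}{k!\,(k+s)!}$, a formal power series in $t$. Then each of the following quantities is equal to $$\left[\frac{t^n}{n!}\right]\det\bigl(I_{i-j}(2t)+I_{i-j-1}(2t)\bigr)_{1\le i,j\le d},$$ where $[t^n/n!]$ denotes $n!$ times the coefficient of $t^n$. 1. The number of palindromic Weyl oscillating lattice walks of length $2n$ starting at $(d,d-1,\dots,1)$, that is, of sequences $w_0,\dots,w_{2n}$ of points of the Weyl chamber $\{x\in\mathbb{Z}^d: x_1>\dots>x_d>0\}$ with $w_0=(d,d-1,\dots,1)$, with every difference $w_i-w_{i-1}$ equal to plus or minus a unit coordinate vector, and with $w_i=w_{2n-i}$ for all $i$. 2. The number of palindromic oscillating tableaux of length $2n$ and height at most $d$. Here an oscillating tableau of shape $\mu$ and length $m$ is a sequence $\varnothing=\mu^0,\mu^1,\dots,\mu^m=\mu$ of Young diagrams, each obtained from the previous one by adding or removing one square; it has height at most $d$ if every $\mu^i$ has at most $d$ rows; and one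 of shape $\varnothing$ is palindromic if it is equal to its reversal. 3. The number of bilaterally symmetric $(d+1)$-noncrossing matchings on $[2n]=\{1,\dots,2n\}$, and also the number of bilaterally symmetric $(d+1)$-nonnesting matchings on $[2n]$. Here a matching is a partition of $[2n]$ into two-element blocks; it is bilaterally symmetric if it is invariant under $i\mapsto 2n+1-i$; and it is $k$-noncrossing (respectively $k$-nonnesting) if it has no $k$ blocks $\{a_1,b_1\},\dots,\{a_k,b_k\}$ with $a_1<\dots<a_k<b_1<\dots<b_k$ (respectively $a_1<\dots<a_k<b_k<\dots<b_1$). 4. The number of oscillating tableaux of length $n$, of any shape, and of height at most $d$. -/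

import Mathlib

namespace Osc

open Finset

/-- The hyperbolic Bessel function `I_s(2t) = [z^s] exp (t (z + z⁻¹))` of the first kind of integer
order `s`, as a formal power series in `t`. Since `exp (t (z + z⁻¹)) = exp (t z) * exp (t z⁻¹)`, the
coefficient of `t ^ m` is the sum of `1 / (k! l!)` over all `k + l = m` with `k - l = s`, that is
`1 / (l! (l + s)!)` if `m = 2 l + s` with `l, l + s ≥ 0`, and `0` otherwise. -/
noncomputable def besselI (s : ℤ) : PowerSeries ℚ :=
  PowerSeries.mk fun m =>
    ∑ p ∈ antidiagonal m,
      if (p.1 : ℤ) - (p.2 : ℤ) = s then 1 / ((p.1.factorial : ℚ) * (p.2.factorial : ℚ)) else 0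

/-- The matrix `(I_{i-j}(2t) + I_{i-j-1}(2t))_{1 ≤ i, j ≤ d}`. (Only `i - j` matters, so the
indices may start from `0`.) -/
noncomputable def besselMatrix (d : ℕ) : Matrix (Fin d) (Fin d) (PowerSeries ℚ) :=
  Matrix.of fun i j => besselI ((i : ℤ) - (j : ℤ)) + besselI ((i : ℤ) - (j : ℤ) - 1)

/-- The sequence `w_0, …, w_m` read backwards. -/
def reversal {α : Type*} {m : ℕ} (w : Fin (m + 1) → α) : Fin (m + 1) → α :=
  fun i => w i.rev

/-- A sequence is palindromic if it equals its reversal. -/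
def IsPalindromic {α : Type*} {m : ℕ} (w : Fin (m + 1) → α) : Prop :=
  w = reversal w

/-- The Weyl chamber `x_1 > ⋯ > x_d > 0` in `ℤ ^ d`. -/
def weylChamber (d : ℕ) : Set (Fin d → ℤ) :=
  {x | StrictAnti x ∧ ∀ i, 0 < x i}

/-- The point `(d, d - 1, …, 1)`. -/
def weylDelta (d : ℕ) : Fin d → ℤ :=
  fun i => (d : ℤ) - (i : ℤ)

/-- `w_0, …, w_m` is a Weyl oscillating lattice walk of length `m` starting at `x`. -/
structure IsWeylWalk {d m : ℕ} (x : Fin d → ℤ) (w : Fin (m + 1) → Fin d → ℤ) : Prop where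
  start : w 0 = x
  mem_chamber : ∀ i, w i ∈ weylChamber d
  step : ∀ i : Fin m, ∃ k : Fin d,
    w i.succ = w i.castSucc + Pi.single k 1 ∨ w i.succ = w i.castSucc - Pi.single k 1

/-- `ν` is obtained from `μ` by adding one square. -/
def AddsSquare (μ ν : YoungDiagram) : Prop :=
  ∃ c : ℕ × ℕ, c ∉ μ.cells ∧ ν.cells = insert c μ.cells

/-- `T_0, …, T_m` is an oscillating tableau of shape `μ` and length `m`. -/
structure IsOscillatingTableau {m : ℕ} (μ : YoungDiagram) (T : Fin (m + 1) → YoungDiagram) :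
    Prop where
  start : T 0 = ⊥
  shape : T (Fin.last m) = μ
  step : ∀ i : Fin m, AddsSquare (T i.castSucc) (T i.succ) ∨ AddsSquare (T i.succ) (T i.castSucc)

/-- Every diagram in the sequence has height (number of rows, i.e. length of the first column) at
most `d`. -/
def HeightLE {m : ℕ} (d : ℕ) (T : Fin (m + 1) → YoungDiagram) : Prop :=
  ∀ i, (T i).colLen 0 ≤ d

/-- Set partitions of `[2n]`; the element `i` of `[2n]` is `i - 1 : Fin (2 * n)`. -/
abbrev SetPartition (n : ℕ) : Type :=
  Finpartition (univ : Finset (Fin (2 * n)))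

/-- A matching on `[2n]` is a partition of `[2n]` into two-element blocks. -/
def IsMatching {n : ℕ} (M : SetPartition n) : Prop :=
  ∀ b ∈ M.parts, b.card = 2

/-- `(i, j)` with `i < j` is an edge. -/
def IsArc {n : ℕ} (M : SetPartition n) (i j : Fin (2 * n)) : Prop :=
  i < j ∧ {i, j} ∈ M.parts

/-- `M` has a `k`-crossing: arcs `(a_1, b_1), …, (a_k, b_k)` with
`a_1 < ⋯ < a_k < b_1 < ⋯ < b_k`. -/
def HasCrossing {n : ℕ} (k : ℕ) (M : SetPartition n) : Prop :=
  ∃ a b : Fin k → Fin (2 * n), StrictMono a ∧ StrictMono b ∧ (∀ r s, a r < b s) ∧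
    ∀ r, IsArc M (a r) (b r)

/-- `M` has a `k`-nesting: arcs `(a_1, b_1), …, (a_k, b_k)` with
`a_1 < ⋯ < a_k < b_k < ⋯ < b_1`. -/
def HasNesting {n : ℕ} (k : ℕ) (M : SetPartition n) : Prop :=
  ∃ a b : Fin k → Fin (2 * n), StrictMono a ∧ StrictAnti b ∧ (∀ r s, a r < b s) ∧
    ∀ r, IsArc M (a r) (b r)

/-- `M` is invariant under the reflection `i ↦ 2n + 1 - i` of `[2n]`. -/
def IsBilaterallySymmetric {n : ℕ} (M : SetPartition n) : Prop :=
  M.parts.image (fun b => b.image Fin.rev) = M.parts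

/-- Palindromic Weyl oscillating lattice walks of length `2n` starting at `(d, …, 1)`. -/
def palindromicWalks (d n : ℕ) : Set (Fin (2 * n + 1) → Fin d → ℤ) :=
  {w | IsWeylWalk (weylDelta d) w ∧ IsPalindromic w}

/-- Palindromic oscillating tableaux (necessarily of empty shape) of length `2n` and of height
at most `d`. -/
def palindromicTableaux (d n : ℕ) : Set (Fin (2 * n + 1) → YoungDiagram) :=
  {T | IsOscillatingTableau ⊥ T ∧ HeightLE d T ∧ IsPalindromic T}

/-- Bilaterally symmetric `(d + 1)`-noncrossing matchings on `[2n]`. -/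
def symmetricNoncrossing (d n : ℕ) : Set (SetPartition n) :=
  {M | IsMatching M ∧ IsBilaterallySymmetric M ∧ ¬ HasCrossing (d + 1) M}

/-- Bilaterally symmetric `(d + 1)`-nonnesting matchings on `[2n]`. -/
def symmetricNonnesting (d n : ℕ) : Set (SetPartition n) :=
  {M | IsMatching M ∧ IsBilaterallySymmetric M ∧ ¬ HasNesting (d + 1) M}

/-- Oscillating tableaux of any shape, of length `n` and of height at most `d`. -/
def boundedTableaux (d n : ℕ) : Set (Fin (n + 1) → YoungDiagram) :=
  {T | (∃ μ, IsOscillatingTableau μ T) ∧ HeightLE d T}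

end Osc

/-! All the sets are brought down to walks of length `n` in the Weyl chamber from
$\delta=(d,\dots,1)$, and those walks are then counted by reflection.

A palindrome is determined by its first half, and both step relations are symmetric, so palindromes
of length $2n$ correspond to arbitrary paths of length $n$ (`encard_palindromic_pathSet`). Adding
$\delta$ to the row lengths turns diagrams with at most $d$ rows into chamber points and squares
into unit vectors (`bijOn_latticePoint`).

Matchings are handled by Fomin growth diagrams. A matching is a 0-1 filling of a staircase; the rows
of the growth diagram are the chain lengths of Viennot's iterated shadows, and they obey a max/min
local rule that can be run inwards. The boundary of the diagram is thus an oscillating tableau that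
determines the filling, and every such tableau occurs (`IsOscSeq.exists_filling`). Transposing the
filling reverses the tableau, so symmetric matchings give palindromes (`bijOn_tableauOfMatching`).
The number of rows is a longest antichain (crossings, `IsPartialPerm.growthRow_ne_zero_iff`), the
first row a longest chain (nestings, `IsPartialPerm.le_chainLen_iff`); transposing diagrams
exchanges the two bounds.

For the count, pair the Laurent polynomial $\prod_i(z_i^{x_i}-z_i^{-x_i})\cdot(\sum_k
z_k+z_k^{-1})^n$ with the antisymmetrised indicator of the chamber. The pairing satisfies the walk
recursion and vanishes on the walls, hence counts walks with free endpoint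
(`encard_pathSet_weylChamber`). At $\delta$ the product antisymmetrises to a symplectic alternant,
which is an ordinary alternant times $\prod(1-z_i^{-1})\prod_{i<j}(1-z_i^{-1}z_j^{-1})$
(`det_oddVar`). By Littlewood's identity (`prod_mul_orderSeries`) this factor collapses the sum over
all endpoints to the signed permutations of $(1,\dots,d)$. The remaining coefficients of powers of
the step polynomial are products of Bessel series, and the signed sum is the determinant
(`signedWalkSum_eq_coeff_det`). -/

namespace Osc

open Finset

/-! ### Growth diagrams through iterated shadows -/

/-- For a filling `x` of the quarter plane, the maximal weight of a north-east chain in the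
rectangle of cells `(a, b)` with `a < i` and `b < j`, when `x` is a partial permutation matrix. -/
def chainLen (x : ℕ → ℕ → ℕ) : ℕ → ℕ → ℕ
  | 0, _ => 0
  | _ + 1, 0 => 0
  | i + 1, j + 1 => max (chainLen x i (j + 1)) (chainLen x (i + 1) j) + x i j

/-- The filling by the inner corners of the shadow lines of `x` (Viennot). -/
def shadow (x : ℕ → ℕ → ℕ) (i j : ℕ) : ℕ :=
  min (chainLen x i (j + 1)) (chainLen x (i + 1) j) - chainLen x i j

/-- The `k`-th row length at the lattice point `(i, j)` of the growth diagram of `x`. -/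
def growthRow (x : ℕ → ℕ → ℕ) (k : ℕ) : ℕ → ℕ → ℕ :=
  chainLen (shadow^[k] x)

/-- The transposed filling. -/
def transposeFilling (x : ℕ → ℕ → ℕ) : ℕ → ℕ → ℕ := fun i j => x j i

section chainLen

variable (x : ℕ → ℕ → ℕ)

@[simp] theorem chainLen_zero_left (j : ℕ) : chainLen x 0 j = 0 := by rw [chainLen]

@[simp] theorem chainLen_zero_right (i : ℕ) : chainLen x i 0 = 0 := by
  cases i <;> rw [chainLen]

@[simp] theorem growthRow_zero_left (k j : ℕ) : growthRow x k 0 j = 0 := chainLen_zero_left _ _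

@[simp] theorem growthRow_zero_right (k i : ℕ) : growthRow x k i 0 = 0 := chainLen_zero_right _ _

theorem chainLen_succ_succ (i j : ℕ) : chainLen x (i + 1) (j + 1) =
    max (chainLen x i (j + 1)) (chainLen x (i + 1) j) + x i j := by
  rw [chainLen]

theorem chainLen_le_succ_left (i j : ℕ) : chainLen x i j ≤ chainLen x (i + 1) j := by
  cases j with
  | zero => simp
  | succ j => rw [chainLen_succ_succ]; omega

theorem chainLen_le_succ_right (i j : ℕ) : chainLen x i j ≤ chainLen x i (j + 1) := by
  cases i with
  | zero => simp
  | succ i => rw [chainLen_succ_succ]; omega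

theorem chainLen_mono {i i' j j' : ℕ} (hi : i ≤ i') (hj : j ≤ j') :
    chainLen x i j ≤ chainLen x i' j' :=
  (monotone_nat_of_le_succ (f := fun i => chainLen x i j)
    (fun i => chainLen_le_succ_left x i j) hi).trans
  (monotone_nat_of_le_succ (f := fun j => chainLen x i' j)
    (fun j => chainLen_le_succ_right x i' j) hj)

theorem chainLen_add_shadow (i j : ℕ) : chainLen x i j + shadow x i j =
    min (chainLen x i (j + 1)) (chainLen x (i + 1) j) := by
  have h1 := chainLen_le_succ_left x i j
  have h2 := chainLen_le_succ_right x i j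
  rw [shadow]; omega

theorem chainLen_transposeFilling (i j : ℕ) :
    chainLen (transposeFilling x) i j = chainLen x j i := by
  induction i generalizing j with
  | zero => simp
  | succ i ih =>
    induction j with
    | zero => simp
    | succ j ihj =>
      rw [chainLen_succ_succ, chainLen_succ_succ, ihj, ih, max_comm]; rfl

theorem shadow_transposeFilling :
    shadow (transposeFilling x) = transposeFilling (shadow x) := by
  funext i j
  simp only [shadow, chainLen_transposeFilling, transposeFilling]
  rw [min_comm]

theorem growthRow_transposeFilling (k i j : ℕ) :
    growthRow (transposeFilling x) k i j = growthRow x k j i := by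
  have h : shadow^[k] (transposeFilling x) = transposeFilling (shadow^[k] x) := by
    induction k with
    | zero => rfl
    | succ k ih =>
      rw [Function.iterate_succ_apply', Function.iterate_succ_apply', ih,
        shadow_transposeFilling]
  rw [growthRow, h, chainLen_transposeFilling, growthRow]

/-- Conservation of the marks along a row. -/
theorem chainLen_row (i j : ℕ) :
    chainLen x (i + 1) j + ∑ b ∈ range j, shadow x i b =
      chainLen x i j + ∑ b ∈ range j, x i b := by
  induction j with
  | zero => simp
  | succ j ih =>
    rw [sum_range_succ, sum_range_succ, chainLen_succ_succ]
    have := chainLen_add_shadow x i j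
    omega

/-- Conservation of the marks along a column. -/
theorem chainLen_col (i j : ℕ) :
    chainLen x i (j + 1) + ∑ a ∈ range i, shadow x a j =
      chainLen x i j + ∑ a ∈ range i, x a j := by
  have := chainLen_row (transposeFilling x) j i
  simpa only [chainLen_transposeFilling, shadow_transposeFilling, transposeFilling] using this

/-- If both neighbouring lengths for the shadow are at most `chainLen x i j`, then adding the mark
`shadow x i j` gives at most `chainLen x i j + shadow x i j`, which is the minimum of the two
neighbours for `x`. This is the interlacing of consecutive rows. -/
theorem chainLen_shadow_le (i j : ℕ) : chainLen (shadow x) (i + 1) j ≤ chainLen x i j ∧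
    chainLen (shadow x) i (j + 1) ≤ chainLen x i j := by
  have key : ∀ i j, chainLen (shadow x) (i + 1) j ≤ chainLen x i j →
      chainLen (shadow x) i (j + 1) ≤ chainLen x i j →
      chainLen (shadow x) (i + 1) (j + 1) ≤ chainLen x i (j + 1) ∧
      chainLen (shadow x) (i + 1) (j + 1) ≤ chainLen x (i + 1) j := by
    intro i j h1 h2
    rw [chainLen_succ_succ]
    have := chainLen_add_shadow x i j
    omega
  induction i generalizing j with
  | zero =>
    refine ⟨?_, by simp⟩
    induction j with
    | zero => simp
    | succ j ih => exact (key 0 j ih (by simp)).1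
  | succ i ih =>
    induction j with
    | zero => exact ⟨by simp, (key i 0 (ih 0).1 (ih 0).2).2⟩
    | succ j ihj =>
      exact ⟨(key (i + 1) j ihj.1 ihj.2).1, (key i (j + 1) (ih _).1 (ih _).2).2⟩

end chainLen

section growthRow

variable (x : ℕ → ℕ → ℕ)

theorem growthRow_succ (k : ℕ) : growthRow x (k + 1) = chainLen (shadow (shadow^[k] x)) := by
  rw [growthRow, Function.iterate_succ_apply']

/-- The local rule of the growth diagram. -/
theorem growthRow_succ_succ_succ (k i j : ℕ) :
    growthRow x (k + 1) (i + 1) (j + 1) + growthRow x k i j =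
      max (growthRow x (k + 1) i (j + 1)) (growthRow x (k + 1) (i + 1) j) +
      min (growthRow x k i (j + 1)) (growthRow x k (i + 1) j) := by
  rw [growthRow_succ, chainLen_succ_succ, growthRow, ← chainLen_add_shadow]
  omega

theorem growthRow_succ_le (k i j : ℕ) : growthRow x (k + 1) i j ≤ growthRow x k i j := by
  rw [growthRow_succ, growthRow]
  exact (chainLen_le_succ_left _ _ _).trans (chainLen_shadow_le _ i j).1

theorem growthRow_antitone (i j : ℕ) : Antitone fun k => growthRow x k i j :=
  antitone_nat_of_succ_le fun k => growthRow_succ_le x k i j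

theorem growthRow_eq_zero {k i : ℕ} (h : i ≤ k) (j : ℕ) : growthRow x k i j = 0 := by
  induction k generalizing i j with
  | zero => obtain rfl : i = 0 := by omega
            simp
  | succ k ih =>
    cases i with
    | zero => simp
    | succ i =>
      have h1 := (chainLen_shadow_le (shadow^[k] x) i j).1
      have h2 := ih (i := i) (by omega) j
      rw [growthRow] at h2
      rw [growthRow_succ]
      omega

theorem growthRow_row (k i j : ℕ) :
    growthRow x k (i + 1) j + ∑ b ∈ range j, (shadow^[k + 1] x) i b =
      growthRow x k i j + ∑ b ∈ range j, (shadow^[k] x) i b := by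
  rw [Function.iterate_succ_apply']
  exact chainLen_row _ i j

theorem iterate_shadow_eq_zero {k i : ℕ} (h : i < k) (j : ℕ) : (shadow^[k] x) i j = 0 := by
  obtain ⟨k, rfl⟩ : ∃ l, k = l + 1 := ⟨k - 1, by omega⟩
  have h1 := growthRow_eq_zero x (show i ≤ k by omega) (j + 1)
  rw [growthRow] at h1
  rw [Function.iterate_succ_apply', shadow, h1]
  simp

/-- Conservation of marks telescopes over the iterated shadows, and the `K`-th shadow has nothing
left in row `i` once `i < K`. So the size of the shape grows by the number of points passed. -/
theorem sum_growthRow_row {K i : ℕ} (hK : i < K) (j : ℕ) :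
    ∑ k ∈ range K, growthRow x k (i + 1) j =
      ∑ k ∈ range K, growthRow x k i j + ∑ b ∈ range j, x i b := by
  have h : ∀ K, ∑ k ∈ range K, growthRow x k (i + 1) j + ∑ b ∈ range j, (shadow^[K] x) i b =
      ∑ k ∈ range K, growthRow x k i j + ∑ b ∈ range j, x i b := by
    intro K
    induction K with
    | zero => simp
    | succ K ih =>
      rw [sum_range_succ, sum_range_succ]
      have := growthRow_row x K i j
      omega
  rw [← h K, sum_eq_zero (s := range j) fun b _ => iterate_shadow_eq_zero x hK b, add_zero]

end growthRow

/-! ### Greene's theorem for chains and antichains of a partial permutation -/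

theorem shadow_ne_zero_iff {x : ℕ → ℕ → ℕ} {i j : ℕ} : shadow x i j ≠ 0 ↔
    chainLen x i (j + 1) ≠ chainLen x i j ∧ chainLen x (i + 1) j ≠ chainLen x i j := by
  have := chainLen_add_shadow x i j
  have := chainLen_le_succ_left x i j
  have := chainLen_le_succ_right x i j
  omega

/-- A `0`-`1` filling with at most one nonzero entry in every row and column. -/
structure IsPartialPerm (x : ℕ → ℕ → ℕ) : Prop where
  row : ∀ i j, ∑ b ∈ range j, x i b ≤ 1
  col : ∀ i j, ∑ a ∈ range i, x a j ≤ 1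

namespace IsPartialPerm

variable {x : ℕ → ℕ → ℕ}

theorem transposeFilling (hx : IsPartialPerm x) : IsPartialPerm (transposeFilling x) :=
  ⟨fun i j => hx.col j i, fun i j => hx.row j i⟩

/-- Chain lengths increase, so by conservation the shadow has no more marks than `x` in any initial
piece of a row or column. -/
theorem shadow (hx : IsPartialPerm x) : IsPartialPerm (shadow x) := by
  refine ⟨fun i j => ?_, fun i j => ?_⟩
  · have := chainLen_row x i j
    have := chainLen_le_succ_left x i j
    have := hx.row i j
    omega
  · have := chainLen_col x i j
    have := chainLen_le_succ_right x i j
    have := hx.col i j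
    omega

theorem iterate_shadow (hx : IsPartialPerm x) (k : ℕ) : IsPartialPerm (Osc.shadow^[k] x) := by
  induction k with
  | zero => exact hx
  | succ k ih => rw [Function.iterate_succ_apply']; exact ih.shadow

theorem row_unique (hx : IsPartialPerm x) {i j j' : ℕ} (h : x i j ≠ 0) (h' : x i j' ≠ 0) :
    j = j' := by
  by_contra hne
  have h1 := hx.row i (max j j' + 1)
  have h2 : ∑ b ∈ {j, j'}, x i b ≤ ∑ b ∈ range (max j j' + 1), x i b :=
    sum_le_sum_of_subset (by
      intro b hb
      simp only [mem_insert, mem_singleton] at hb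
      simp only [mem_range]
      omega)
  rw [sum_pair hne] at h2
  omega

theorem chainLen_left_of_ne (hx : IsPartialPerm x) {i j : ℕ} (h : x i j ≠ 0) :
    chainLen x (i + 1) j = chainLen x i j := by
  have h1 := chainLen_row x i j
  have h2 := hx.row i (j + 1)
  have h3 := chainLen_le_succ_left x i j
  rw [sum_range_succ] at h2
  omega

theorem chainLen_right_of_ne (hx : IsPartialPerm x) {i j : ℕ} (h : x i j ≠ 0) :
    chainLen x i (j + 1) = chainLen x i j := by
  simpa only [chainLen_transposeFilling] using
    hx.transposeFilling.chainLen_left_of_ne (i := j) (j := i) h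

theorem chainLen_succ_of_ne (hx : IsPartialPerm x) {i j : ℕ} (h : x i j ≠ 0) :
    chainLen x (i + 1) (j + 1) = chainLen x i j + 1 := by
  have h1 := hx.chainLen_left_of_ne h
  have h2 := hx.chainLen_right_of_ne h
  have h3 := hx.row i (j + 1)
  rw [sum_range_succ] at h3
  rw [chainLen_succ_succ]
  omega

/-- The shadow line going up a column starts at a point of the filling. -/
theorem exists_source_col {i j : ℕ}
    (h : chainLen x i (j + 1) ≠ chainLen x i j) :
    ∃ s < i, x s j ≠ 0 ∧
      ∀ i', s < i' → i' ≤ i → chainLen x i' (j + 1) ≠ chainLen x i' j := by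
  induction i with
  | zero => simp at h
  | succ i ih =>
    by_cases hx0 : x i j = 0
    · have hi : chainLen x i (j + 1) ≠ chainLen x i j := by
        rw [chainLen_succ_succ, hx0] at h
        have := chainLen_le_succ_left x i j
        omega
      obtain ⟨s, hs, hxs, hall⟩ := ih hi
      refine ⟨s, by omega, hxs, fun i' h1 h2 => ?_⟩
      rcases Nat.lt_or_ge i i' with h3 | h3
      · obtain rfl : i' = i + 1 := by omega
        exact h
      · exact hall i' h1 h3
    · refine ⟨i, by omega, hx0, fun i' h1 h2 => ?_⟩
      obtain rfl : i' = i + 1 := by omega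
      exact h

theorem exists_source_row {i j : ℕ}
    (h : chainLen x (i + 1) j ≠ chainLen x i j) :
    ∃ s < j, x i s ≠ 0 ∧
      ∀ j', s < j' → j' ≤ j → chainLen x (i + 1) j' ≠ chainLen x i j' := by
  simpa only [chainLen_transposeFilling, Osc.transposeFilling] using
    exists_source_col (x := Osc.transposeFilling x) (i := j) (j := i)
      (by simpa only [chainLen_transposeFilling] using h)

/-- Going up a column from a point, the shadow line persists as long as there is no corner. -/
theorem mark_col_of_ne (hx : IsPartialPerm x) {s i j : ℕ} (h : x s j ≠ 0) (hi : s < i)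
    (hs : ∀ i', s < i' → i' < i → Osc.shadow x i' j = 0) :
    chainLen x i (j + 1) ≠ chainLen x i j := by
  induction i, hi using Nat.le_induction with
  | base =>
    rw [hx.chainLen_succ_of_ne h, hx.chainLen_left_of_ne h]; omega
  | succ i hi ih =>
    have h1 := ih fun i' h1 h2 => hs i' h1 (by omega)
    have h2 := hs i (by omega) (by omega)
    have h3 := mt (fun h' => shadow_ne_zero_iff.2 ⟨h1, h'⟩) (not_not.2 h2)
    have := chainLen_le_succ_right x i j
    rw [chainLen_succ_succ]
    omega

theorem mark_row_of_ne (hx : IsPartialPerm x) {i s j : ℕ} (h : x i s ≠ 0) (hj : s < j)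
    (hs : ∀ j', s < j' → j' < j → Osc.shadow x i j' = 0) :
    chainLen x (i + 1) j ≠ chainLen x i j := by
  have := hx.transposeFilling.mark_col_of_ne (s := s) (i := j) (j := i) h hj
    (by simpa only [shadow_transposeFilling, Osc.transposeFilling] using hs)
  simpa only [chainLen_transposeFilling] using this

/-- Between two points in decreasing position there is a corner. -/
theorem exists_shadow_between (hx : IsPartialPerm x) {i j i' j' : ℕ} (h : x i j ≠ 0)
    (h' : x i' j' ≠ 0) (hi : i < i') (hj : j' < j) :
    ∃ u v, i < u ∧ u ≤ i' ∧ j' < v ∧ v ≤ j ∧ Osc.shadow x u v ≠ 0 := by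
  by_contra! hcon
  -- Without corners the lines leaving the two points run on until they meet at `(i', j)`, and there
  -- they form one.
  have h1 := hx.mark_col_of_ne h hi fun u h1 h2 => hcon u j h1 h2.le hj le_rfl
  have h2 := hx.mark_row_of_ne h' hj fun v h1 h2 => hcon i' v hi le_rfl h1 h2.le
  exact shadow_ne_zero_iff.2 ⟨h1, h2⟩ (hcon i' j hi le_rfl hj le_rfl)

/-- Between two corners in decreasing position there is a point. -/
theorem exists_between_shadow (hx : IsPartialPerm x) {u v u' v' : ℕ} (h : Osc.shadow x u v ≠ 0)
    (h' : Osc.shadow x u' v' ≠ 0) (hu : u < u') (hv : v' < v) :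
    ∃ i j, u ≤ i ∧ i < u' ∧ v' ≤ j ∧ j < v ∧ x i j ≠ 0 := by
  obtain ⟨t, ht, hxt, hallt⟩ := exists_source_row (shadow_ne_zero_iff.1 h).2
  obtain ⟨s, hs, hxs, halls⟩ := exists_source_col (shadow_ne_zero_iff.1 h').1
  by_cases h1 : v' ≤ t
  · exact ⟨u, t, le_rfl, hu, h1, ht, hxt⟩
  by_cases h2 : u ≤ s
  · exact ⟨s, v', h2, hs, le_rfl, hv, hxs⟩
  -- If neither source lies in the required range, both lines pass through `(u, v')`, which is then
  -- a second corner in row `u`.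
  have h3 := shadow_ne_zero_iff.2
    ⟨halls u (by omega) hu.le, hallt v' (by omega) hv.le⟩
  have := hx.shadow.row_unique h3 h
  omega

end IsPartialPerm

/-- There are `k` points of the filling in decreasing position in the given rectangle. -/
def HasAntichain (x : ℕ → ℕ → ℕ) (k I J : ℕ) : Prop :=
  ∃ a b : Fin k → ℕ, StrictMono a ∧ StrictAnti b ∧
    ∀ r, a r < I ∧ b r < J ∧ x (a r) (b r) ≠ 0

/-- There are `k` points of the filling in increasing position in the given rectangle. -/
def HasChain (x : ℕ → ℕ → ℕ) (k I J : ℕ) : Prop :=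
  ∃ a b : Fin k → ℕ, StrictMono a ∧ StrictMono b ∧
    ∀ r, a r < I ∧ b r < J ∧ x (a r) (b r) ≠ 0

/-- Points and corners in decreasing position alternate: a corner lies between two points and a
point between two corners, and the lines through the first and the last corner supply one further
point at each end. For `k = 0` there is no corner to supply them, whence `hk`. -/
theorem IsPartialPerm.hasAntichain_shadow_iff {x : ℕ → ℕ → ℕ} (hx : IsPartialPerm x) {k : ℕ}
    (hk : k ≠ 0) (I J : ℕ) : HasAntichain (Osc.shadow x) k I J ↔ HasAntichain x (k + 1) I J := by
  obtain ⟨k, rfl⟩ := Nat.exists_eq_succ_of_ne_zero hk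
  constructor
  · rintro ⟨u, v, hu, hv, huv⟩
    -- Point `m` is to come after corners `0, …, m - 1` and before the others; comparing consecutive
    -- points with the corner between them then gives monotonicity.
    have key : ∀ m : Fin (k + 2), ∃ p : ℕ × ℕ, p.1 < I ∧ p.2 < J ∧ x p.1 p.2 ≠ 0 ∧
        ∀ l : Fin (k + 1), (l.val < m.val → u l ≤ p.1 ∧ p.2 < v l) ∧
          (m.val ≤ l.val → p.1 < u l ∧ v l ≤ p.2) := by
      intro m
      rcases Nat.eq_zero_or_pos m.val with h0 | h0
      · obtain ⟨s, hs, hxs, -⟩ :=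
          exists_source_col (shadow_ne_zero_iff.1 (huv 0).2.2).1
        refine ⟨(s, v 0), hs.trans (huv 0).1, (huv 0).2.1, hxs, fun l =>
          ⟨fun h => by omega, fun _ => ⟨hs.trans_le (hu.monotone (Fin.zero_le l)),
            hv.antitone (Fin.zero_le l)⟩⟩⟩
      by_cases hk1 : m.val ≤ k
      · have hlt : (⟨m.val - 1, by omega⟩ : Fin (k + 1)) < ⟨m.val, by omega⟩ := by
          rw [Fin.mk_lt_mk]; omega
        obtain ⟨i, j, h1, h2, h3, h4, h5⟩ := hx.exists_between_shadow (huv ⟨m.val - 1, by omega⟩).2.2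
          (huv ⟨m.val, by omega⟩).2.2 (hu hlt) (hv hlt)
        refine ⟨(i, j), h2.trans (huv _).1, h4.trans (huv _).2.1, h5, fun l => ⟨fun h => ?_,
          fun h => ?_⟩⟩
        · have hl : l ≤ ⟨m.val - 1, by omega⟩ := by rw [Fin.le_def]; simp only; omega
          exact ⟨(hu.monotone hl).trans h1, h4.trans_le (hv.antitone hl)⟩
        · have hl : ⟨m.val, by omega⟩ ≤ l := by rw [Fin.le_def]; simpa using h
          exact ⟨h2.trans_le (hu.monotone hl), (hv.antitone hl).trans h3⟩
      · obtain ⟨t, ht, hxt, -⟩ :=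
          exists_source_row (shadow_ne_zero_iff.1 (huv (Fin.last k)).2.2).2
        refine ⟨(u (Fin.last k), t), (huv _).1, ht.trans (huv _).2.1, hxt, fun l =>
          ⟨fun h => ⟨hu.monotone (Fin.le_last l), ht.trans_le (hv.antitone (Fin.le_last l))⟩,
            fun h => by omega⟩⟩
    choose p h1 h2 h3 h4 using key
    refine ⟨fun m => (p m).1, fun m => (p m).2, Fin.strictMono_iff_lt_succ.2 fun m => ?_,
      Fin.strictAnti_iff_succ_lt.2 fun m => ?_, fun r => ⟨h1 r, h2 r, h3 r⟩⟩
    · exact ((h4 m.castSucc m).2 (by simp)).1.trans_le ((h4 m.succ m).1 (by simp)).1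
    · exact ((h4 m.succ m).1 (by simp)).2.trans_le ((h4 m.castSucc m).2 (by simp)).2
  · rintro ⟨a, b, ha, hb, hab⟩
    have key := fun m : Fin (k + 1) => hx.exists_shadow_between (hab m.castSucc).2.2
      (hab m.succ).2.2 (ha m.castSucc_lt_succ) (hb m.castSucc_lt_succ)
    choose u v h1 h2 h3 h4 h5 using key
    refine ⟨u, v, Fin.strictMono_iff_lt_succ.2 fun m => ?_,
      Fin.strictAnti_iff_succ_lt.2 fun m => ?_, fun r => ⟨(h2 r).trans_lt (hab _).1,
        (h4 r).trans_lt (hab _).2.1, h5 r⟩⟩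
    · refine (h2 m.castSucc).trans_lt ?_
      rw [Fin.succ_castSucc]
      exact h1 m.succ
    · refine (h4 m.succ).trans_lt ?_
      rw [← Fin.succ_castSucc]
      exact h3 m.castSucc

theorem hasAntichain_one_iff {x : ℕ → ℕ → ℕ} {I J : ℕ} :
    HasAntichain x 1 I J ↔ chainLen x I J ≠ 0 := by
  constructor
  · rintro ⟨a, b, -, -, h⟩
    obtain ⟨h1, h2, h3⟩ := h 0
    have h4 := chainLen_mono x (Nat.succ_le_of_lt h1) (Nat.succ_le_of_lt h2)
    rw [Nat.succ_eq_add_one, Nat.succ_eq_add_one, chainLen_succ_succ] at h4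
    omega
  · intro h
    suffices H : ∃ i < I, ∃ j < J, x i j ≠ 0 by
      obtain ⟨i, hi, j, hj, hx⟩ := H
      exact ⟨fun _ => i, fun _ => j, Subsingleton.strictMono _, Subsingleton.strictAnti _,
        fun _ => ⟨hi, hj, hx⟩⟩
    by_contra! hcon
    apply h
    have : ∀ i ≤ I, ∀ j ≤ J, chainLen x i j = 0 := by
      intro i
      induction i with
      | zero => simp
      | succ i ih =>
        intro hi j
        induction j with
        | zero => simp
        | succ j ihj =>
          intro hj
          rw [chainLen_succ_succ, ih (by omega) _ hj, ihj (by omega), hcon i (by omega) j (by omega)]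
          simp
    exact this I le_rfl J le_rfl

/-- The number of rows of the growth diagram is the maximal length of a decreasing sequence. -/
theorem IsPartialPerm.growthRow_ne_zero_iff {x : ℕ → ℕ → ℕ} (hx : IsPartialPerm x) (d I J : ℕ) :
    growthRow x d I J ≠ 0 ↔ HasAntichain x (d + 1) I J := by
  rw [growthRow, ← hasAntichain_one_iff]
  -- Each shadow shortens antichains by one; the free `k` lets the induction trade shadows for
  -- length.
  suffices H : ∀ k, HasAntichain (Osc.shadow^[d] x) (k + 1) I J ↔ HasAntichain x (d + k + 1) I J from
    H 0
  induction d with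
  | zero => intro k; rw [zero_add]; rfl
  | succ d ih =>
    intro k
    rw [Function.iterate_succ_apply', (hx.iterate_shadow d).hasAntichain_shadow_iff (by omega), ih]
    rw [show d + (k + 1) = d + 1 + k by omega]

theorem strictMono_snoc {k : ℕ} {a : Fin k → ℕ} (ha : StrictMono a) {i : ℕ}
    (hi : ∀ r, a r < i) : StrictMono (Fin.snoc a i : Fin (k + 1) → ℕ) := by
  intro r s
  refine Fin.lastCases (fun h => absurd h (Fin.le_last s).not_gt) (fun r => ?_) r
  refine Fin.lastCases (fun _ => by simpa using hi r) (fun s h => ?_) s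
  simp only [Fin.snoc_castSucc]
  exact ha (by simpa using h)

/-- The first row of the growth diagram is the maximal length of an increasing sequence. -/
theorem IsPartialPerm.le_chainLen_iff {x : ℕ → ℕ → ℕ} (hx : IsPartialPerm x) (k I J : ℕ) :
    k ≤ chainLen x I J ↔ HasChain x k I J := by
  constructor
  · suffices H : ∀ n I J k, I + J = n → k ≤ chainLen x I J → HasChain x k I J from
      H _ I J k rfl
    intro n
    induction n using Nat.strong_induction_on with
    | _ n ih =>
    intro I J k hn hk
    cases k with
    | zero => exact ⟨Fin.elim0, Fin.elim0, Subsingleton.strictMono _, Subsingleton.strictMono _,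
        fun r => r.elim0⟩
    | succ k =>
    cases I with
    | zero => simp at hk
    | succ i =>
    cases J with
    | zero => simp at hk
    | succ j =>
    by_cases h0 : x i j = 0
    · rw [chainLen_succ_succ, h0, add_zero, le_max_iff] at hk
      rcases hk with hk | hk
      · obtain ⟨a, b, ha, hb, hab⟩ := ih _ (by omega) i (j + 1) (k + 1) rfl hk
        exact ⟨a, b, ha, hb, fun r => ⟨(hab r).1.trans (by omega), (hab r).2⟩⟩
      · obtain ⟨a, b, ha, hb, hab⟩ := ih _ (by omega) (i + 1) j (k + 1) rfl hk
        exact ⟨a, b, ha, hb, fun r => ⟨(hab r).1, (hab r).2.1.trans (by omega), (hab r).2.2⟩⟩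
    · rw [hx.chainLen_succ_of_ne h0] at hk
      obtain ⟨a, b, ha, hb, hab⟩ := ih _ (by omega) i j k rfl (by omega)
      refine ⟨Fin.snoc a i, Fin.snoc b j, ?_, ?_, ?_⟩
      · exact strictMono_snoc ha fun r => (hab r).1
      · exact strictMono_snoc hb fun r => (hab r).2.1
      · refine Fin.lastCases ?_ fun r => ?_
        · simpa using h0
        · simp only [Fin.snoc_castSucc]
          exact ⟨(hab r).1.trans (by omega), (hab r).2.1.trans (by omega), (hab r).2.2⟩
  · rintro ⟨a, b, ha, hb, hab⟩
    induction k generalizing I J with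
    | zero => simp
    | succ k ih =>
      have hlast : ∀ r : Fin k, r.castSucc < Fin.last k := fun r => Fin.castSucc_lt_last r
      have h1 := ih (a (Fin.last k)) (b (Fin.last k)) (fun r => a r.castSucc)
        (fun r => b r.castSucc) (ha.comp (Fin.strictMono_castSucc)) (hb.comp Fin.strictMono_castSucc)
        (fun r => ⟨ha (hlast r), hb (hlast r), (hab _).2.2⟩)
      obtain ⟨h2, h3, h4⟩ := hab (Fin.last k)
      have h5 := chainLen_mono x (Nat.succ_le_of_lt h2) (Nat.succ_le_of_lt h3)
      rw [Nat.succ_eq_add_one, Nat.succ_eq_add_one, hx.chainLen_succ_of_ne h4] at h5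
      omega

/-! ### Fillings of the staircase and their boundary sequences -/

/-- The sequence `g` is obtained from `f` by adding `1` to a single entry. -/
def AddsOne (f g : ℕ → ℕ) : Prop :=
  ∃ k, ∀ l, g l = f l + if l = k then 1 else 0

/-- The filling of the staircase by a complete matching of `N` points: every point is the opener
of an arc, recorded in its row, or the closer of an arc, recorded in its column. -/
structure IsArcFilling (N : ℕ) (x : ℕ → ℕ → ℕ) : Prop where
  zero : ∀ i j, N ≤ i + j + 1 → x i j = 0
  one : ∀ p < N, ∑ b ∈ range (N - 1 - p), x p b + ∑ a ∈ range p, x a (N - 1 - p) = 1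

/-- An oscillating sequence of partitions, given by their row lengths. -/
structure IsOscSeq (N : ℕ) (T : ℕ → ℕ → ℕ) : Prop where
  start : ∀ k, T 0 k = 0
  finish : ∀ k, T N k = 0
  anti : ∀ p ≤ N, Antitone (T p)
  step : ∀ p < N, AddsOne (T p) (T (p + 1)) ∨ AddsOne (T (p + 1)) (T p)

/-- The partitions on the boundary of the growth diagram of a filling of the staircase. -/
def growthSeq (N : ℕ) (x : ℕ → ℕ → ℕ) (p k : ℕ) : ℕ := growthRow x k p (N - p)

theorem sum_range_eq_of_zero {f : ℕ → ℕ} {m : ℕ} (h : ∀ b, m ≤ b → f b = 0) (n : ℕ) :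
    ∑ b ∈ range n, f b ≤ ∑ b ∈ range m, f b := by
  rcases le_total n m with hnm | hnm
  · exact sum_le_sum_of_subset (range_subset_range.2 hnm)
  · refine (sum_subset (range_subset_range.2 hnm) fun b _ hb => h b ?_).ge
    simpa using hb

namespace IsArcFilling

variable {N : ℕ} {x : ℕ → ℕ → ℕ}

theorem isPartialPerm (hx : IsArcFilling N x) : IsPartialPerm x := by
  constructor
  · intro i j
    by_cases hi : i < N
    · refine (sum_range_eq_of_zero (m := N - 1 - i) (fun b hb => hx.zero i b (by omega)) j).trans ?_
      have := hx.one i hi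
      omega
    · rw [sum_eq_zero fun b _ => hx.zero i b (by omega)]
      exact zero_le_one
  · intro i j
    by_cases hj : j < N
    · refine (sum_range_eq_of_zero (f := fun a => x a j) (m := N - 1 - j)
        (fun b hb => hx.zero b j (by omega)) i).trans ?_
      have := hx.one (N - 1 - j) (by omega)
      rw [show N - 1 - (N - 1 - j) = j by omega] at this
      omega
    · rw [sum_eq_zero fun b _ => hx.zero b j (by omega)]
      exact zero_le_one

theorem transposeFilling (hx : IsArcFilling N x) : IsArcFilling N (transposeFilling x) := by
  refine ⟨fun i j h => hx.zero j i (by omega), fun p hp => ?_⟩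
  have := hx.one (N - 1 - p) (by omega)
  rw [show N - 1 - (N - 1 - p) = p by omega, add_comm] at this
  exact this

end IsArcFilling

/-- The growth diagram is symmetric under transposition, which runs along the boundary backwards.
This is the source of the palindromes. -/
theorem growthSeq_transposeFilling {N : ℕ} (x : ℕ → ℕ → ℕ) {p : ℕ} (hp : p ≤ N) (k : ℕ) :
    growthSeq N (transposeFilling x) p k = growthSeq N x (N - p) k := by
  rw [growthSeq, growthSeq, growthRow_transposeFilling, Nat.sub_sub_self hp]

theorem growthRow_succ_left_of_sum_eq_zero {x : ℕ → ℕ → ℕ} {i j : ℕ}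
    (h : ∑ b ∈ range j, x i b = 0) (k : ℕ) : growthRow x k (i + 1) j = growthRow x k i j := by
  have hS : ∀ k, ∑ b ∈ range j, (shadow^[k] x) i b = 0 := by
    intro k
    induction k with
    | zero => exact h
    | succ k ih =>
      have h1 := growthRow_row x k i j
      have h2 := chainLen_le_succ_left (shadow^[k] x) i j
      rw [growthRow] at h1
      omega
  have h1 := growthRow_row x k i j
  rw [hS, hS] at h1
  omega

/-- The number of marks of the `k`-th shadow in this piece of row `i` decreases in `k` from 1 to 0.
By conservation the single drop is where the square is added. -/
theorem addsOne_growthRow_left {x : ℕ → ℕ → ℕ} {i j : ℕ}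
    (h : ∑ b ∈ range j, x i b = 1) :
    AddsOne (fun k => growthRow x k i j) fun k => growthRow x k (i + 1) j := by
  set S : ℕ → ℕ := fun k => ∑ b ∈ range j, (shadow^[k] x) i b with hS
  have hrow : ∀ k, growthRow x k (i + 1) j + S (k + 1) = growthRow x k i j + S k :=
    fun k => growthRow_row x k i j
  have hanti : Antitone S := antitone_nat_of_succ_le fun k => by
    have h1 := hrow k
    have h2 := chainLen_le_succ_left (shadow^[k] x) i j
    rw [growthRow] at h1
    omega
  have hex : ∃ k, S k = 0 := ⟨i + 1, sum_eq_zero fun b _ => iterate_shadow_eq_zero x (by omega) b⟩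
  have h0 : S 0 = 1 := h
  classical
  have hm := Nat.find_spec hex
  have hmin : ∀ l, l < Nat.find hex → S l ≠ 0 := fun l hl => Nat.find_min hex hl
  generalize Nat.find hex = m at hm hmin
  have hm0 : m ≠ 0 := by rintro rfl; omega
  have hle : ∀ l, S l ≤ 1 := fun l => h0 ▸ hanti (Nat.zero_le l)
  refine ⟨m - 1, fun l => ?_⟩
  beta_reduce
  have h1 := hrow l
  have h2 := hle l
  have h3 := hle (l + 1)
  rcases lt_trichotomy (l + 1) m with h4 | h4 | h4
  · have := hmin l (by omega)
    have := hmin (l + 1) h4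
    rw [if_neg (by omega)]; omega
  · have := hmin l (by omega)
    subst h4
    rw [if_pos (by omega)]; omega
  · have := hanti (show m ≤ l by omega)
    have := hanti (show m ≤ l + 1 by omega)
    rw [if_neg (by omega)]; omega

theorem growthRow_succ_right_of_sum_eq_zero {x : ℕ → ℕ → ℕ} {i j : ℕ}
    (h : ∑ a ∈ range i, x a j = 0) (k : ℕ) : growthRow x k i (j + 1) = growthRow x k i j := by
  simpa only [growthRow_transposeFilling] using
    growthRow_succ_left_of_sum_eq_zero (x := transposeFilling x) (i := j) (j := i) h k

theorem addsOne_growthRow_right {x : ℕ → ℕ → ℕ} {i j : ℕ}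
    (h : ∑ a ∈ range i, x a j = 1) :
    AddsOne (fun k => growthRow x k i j) fun k => growthRow x k i (j + 1) := by
  simpa only [growthRow_transposeFilling] using
    addsOne_growthRow_left (x := transposeFilling x) (i := j) (j := i) h

namespace IsArcFilling

variable {N : ℕ} {x : ℕ → ℕ → ℕ}

/-- Point `i` either closes an arc (no mark in its row, one in its column) or opens one (the
reverse). Hence the shape just inside the boundary equals one of its two boundary neighbours, and
the other has one square more. -/
theorem growthRow_step (hx : IsArcFilling N x) {i j : ℕ} (hij : i + j + 1 = N) :
    ((∀ k, growthRow x k (i + 1) j = growthRow x k i j) ∧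
      AddsOne (fun k => growthRow x k i j) fun k => growthRow x k i (j + 1)) ∨
    ((∀ k, growthRow x k i (j + 1) = growthRow x k i j) ∧
      AddsOne (fun k => growthRow x k i j) fun k => growthRow x k (i + 1) j) := by
  have h1 := hx.one i (by omega)
  rw [show N - 1 - i = j by omega] at h1
  rcases Nat.eq_zero_or_pos (∑ b ∈ range j, x i b) with h2 | h2
  · exact Or.inl ⟨growthRow_succ_left_of_sum_eq_zero h2, addsOne_growthRow_right (by omega)⟩
  · exact Or.inr ⟨growthRow_succ_right_of_sum_eq_zero (by omega),
      addsOne_growthRow_left (by omega)⟩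

theorem isOscSeq (hx : IsArcFilling N x) : IsOscSeq N (growthSeq N x) := by
  refine ⟨fun k => ?_, fun k => ?_, fun p _ => growthRow_antitone x _ _, fun p hp => ?_⟩
  · simp [growthSeq]
  · simp [growthSeq]
  · have h := hx.growthRow_step (i := p) (j := N - p - 1) (by omega)
    have e1 : growthSeq N x p = fun k => growthRow x k p (N - p - 1 + 1) := by
      funext k; rw [growthSeq, show N - p - 1 + 1 = N - p by omega]
    have e2 : growthSeq N x (p + 1) = fun k => growthRow x k (p + 1) (N - p - 1) := rfl
    rw [e1, e2]
    rcases h with ⟨h1, h2⟩ | ⟨h1, h2⟩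
    · right; simp only [h1]; exact h2
    · left; simp only [h1]; exact h2

/-- The shapes inside a growth diagram are determined by the boundary. -/
theorem growthRow_eq_of_growthSeq_eq {y : ℕ → ℕ → ℕ} (hx : IsArcFilling N x)
    (hy : IsArcFilling N y) (h : ∀ p ≤ N, ∀ k, growthSeq N x p k = growthSeq N y p k) :
    ∀ m i j, i + j + m = N → ∀ k, growthRow x k i j = growthRow y k i j := by
  have h0 : ∀ i j, i + j = N → ∀ k, growthRow x k i j = growthRow y k i j := by
    intro i j hij k
    have := h i (by omega) k
    rwa [growthSeq, growthSeq, show N - i = j by omega] at this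
  have hmin : ∀ z, IsArcFilling N z → ∀ i j, i + j + 1 = N → ∀ k,
      growthRow z k i j = min (growthRow z k i (j + 1)) (growthRow z k (i + 1) j) := by
    intro z hz i j hij k
    have h1 : growthRow z k i j ≤ growthRow z k i (j + 1) := chainLen_le_succ_right _ _ _
    have h2 : growthRow z k i j ≤ growthRow z k (i + 1) j := chainLen_le_succ_left _ _ _
    rcases hz.growthRow_step hij with ⟨h3, -⟩ | ⟨h3, -⟩
    · have := h3 k; omega
    · have := h3 k; omega
  intro m
  induction m using Nat.strong_induction_on with
  | _ m ih =>
  intro i j hij k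
  rcases m with _ | _ | m
  · exact h0 i j hij k
  · rw [hmin x hx i j hij, hmin y hy i j hij, h0 i (j + 1) (by omega), h0 (i + 1) j (by omega)]
  -- Further inside, the local rule can be solved for the innermost shape in terms of the three
  -- others.
  · have h1 := growthRow_succ_succ_succ x k i j
    have h2 := growthRow_succ_succ_succ y k i j
    rw [ih m (by omega) (i + 1) (j + 1) (by omega), ih (m + 1) (by omega) i (j + 1) (by omega),
      ih (m + 1) (by omega) (i + 1) j (by omega), ih (m + 1) (by omega) i (j + 1) (by omega),
      ih (m + 1) (by omega) (i + 1) j (by omega)] at h1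
    omega

/-- The boundary determines all the shapes, and the entry of a cell is the increment of the first
row there over the maximum of its two neighbours. -/
theorem eq_of_growthSeq_eq {y : ℕ → ℕ → ℕ} (hx : IsArcFilling N x)
    (hy : IsArcFilling N y) (h : ∀ p ≤ N, ∀ k, growthSeq N x p k = growthSeq N y p k) : x = y := by
  funext i j
  by_cases hij : N ≤ i + j + 1
  · rw [hx.zero i j hij, hy.zero i j hij]
  · have key := growthRow_eq_of_growthSeq_eq hx hy h
    have h1 := chainLen_succ_succ x i j
    have h2 := chainLen_succ_succ y i j
    have k1 := key (N - i - j - 2) (i + 1) (j + 1) (by omega) 0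
    have k2 := key (N - i - j - 1) i (j + 1) (by omega) 0
    have k3 := key (N - i - j - 1) (i + 1) j (by omega) 0
    simp only [growthRow, Function.iterate_zero, id_eq] at k1 k2 k3
    rw [k1, k2, k3] at h1
    omega

theorem transposeFilling_eq_iff (hx : IsArcFilling N x) : Osc.transposeFilling x = x ↔
    ∀ p ≤ N, ∀ k, growthSeq N x p k = growthSeq N x (N - p) k := by
  constructor
  · intro h p hp k
    rw [← growthSeq_transposeFilling x hp, h]
  · intro h
    refine hx.transposeFilling.eq_of_growthSeq_eq hx fun p hp k => ?_
    rw [growthSeq_transposeFilling x hp, h p hp]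

end IsArcFilling

/-! ### Reconstructing the filling from the boundary -/

section inverse

/-- The shape at the lattice point `(p, N - m - p)` recovered from the boundary. -/
def inwardShape (T : ℕ → ℕ → ℕ) : ℕ → ℕ → ℕ → ℕ
  | 0, p, k => T p k
  | 1, p, k => min (T p k) (T (p + 1) k)
  -- The local rule solved for the inner shape; by `inwardShape_strip` the truncated subtraction is
  -- exact on the staircase.
  | m + 2, p, k =>
    max (inwardShape T (m + 1) p (k + 1)) (inwardShape T (m + 1) (p + 1) (k + 1)) +
      min (inwardShape T (m + 1) p k) (inwardShape T (m + 1) (p + 1) k) -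
      inwardShape T m (p + 1) (k + 1)

/-- The skew shape `g / f` is a horizontal strip. -/
def IsHorizontalStrip (f g : ℕ → ℕ) : Prop := ∀ k, f k ≤ g k ∧ g (k + 1) ≤ f k

theorem AddsOne.isHorizontalStrip {f g : ℕ → ℕ} (h : AddsOne f g) (hf : Antitone f)
    (hg : Antitone g) : IsHorizontalStrip f g := by
  obtain ⟨k, hk⟩ := h
  intro l
  have h1 := hk l
  have h2 := hk (l + 1)
  have h3 := hf (Nat.le_succ l)
  have h4 := hg (Nat.le_succ l)
  simp only [Nat.succ_eq_add_one] at h3 h4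
  split_ifs at h1 h2 <;> omega

namespace IsOscSeq

variable {N : ℕ} {T : ℕ → ℕ → ℕ}

theorem eq_zero_of_le (hT : IsOscSeq N T) {p : ℕ} (hp : p ≤ N) {k : ℕ} (hk : p ≤ k) :
    T p k = 0 := by
  induction p generalizing k with
  | zero => exact hT.start k
  | succ p ih =>
    obtain ⟨k, rfl⟩ : ∃ l, k = l + 1 := ⟨k - 1, by omega⟩
    have h1 := ih (by omega) (show p ≤ k + 1 by omega)
    have h2 := ih (by omega) (show p ≤ k by omega)
    have h3 := hT.anti (p + 1) hp (Nat.le_succ k)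
    rw [Nat.succ_eq_add_one] at h3
    rcases hT.step p (by omega) with ⟨l, hl⟩ | ⟨l, hl⟩
    · have h4 := hl k
      have h5 := hl (k + 1)
      split_ifs at h4 h5 <;> omega
    · have h5 := hl (k + 1)
      omega

/-- Interlacing reproduces itself inwards. Entry `k + 1` of the outer shape lies between the maximum
of the neighbours' entries `k + 1` and the minimum of their entries `k`; the local rule reflects it
in this interval, so the new entry lies there too. -/
theorem inwardShape_strip (hT : IsOscSeq N T) (m p : ℕ) (h : p + m + 1 ≤ N) :
    IsHorizontalStrip (inwardShape T (m + 1) p) (inwardShape T m p) ∧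
    IsHorizontalStrip (inwardShape T (m + 1) p) (inwardShape T m (p + 1)) := by
  induction m generalizing p with
  | zero =>
    have a1 := hT.anti p (by omega)
    have a2 := hT.anti (p + 1) (by omega)
    have triv : ∀ f : ℕ → ℕ, Antitone f → IsHorizontalStrip f f :=
      fun f hf k => ⟨le_rfl, hf (Nat.le_succ k)⟩
    rcases hT.step p (by omega) with h1 | h1
    · have e : inwardShape T (0 + 1) p = T p := by
        funext k
        have := (h1.isHorizontalStrip a1 a2 k).1
        simp only [inwardShape]; omega
      rw [e]
      exact ⟨triv _ a1, h1.isHorizontalStrip a1 a2⟩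
    · have e : inwardShape T (0 + 1) p = T (p + 1) := by
        funext k
        have := (h1.isHorizontalStrip a2 a1 k).1
        simp only [inwardShape]; omega
      rw [e]
      exact ⟨h1.isHorizontalStrip a2 a1, triv _ a2⟩
  | succ m ih =>
    have h1 := ih p (by omega)
    have h2 := ih (p + 1) (by omega)
    have key : ∀ k, inwardShape T (m + 1 + 1) p k ≤
        min (inwardShape T (m + 1) p k) (inwardShape T (m + 1) (p + 1) k) ∧
        max (inwardShape T (m + 1) p (k + 1)) (inwardShape T (m + 1) (p + 1) (k + 1)) ≤
        inwardShape T (m + 1 + 1) p k := by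
      intro k
      have e1 := h1.2 k
      have e2 := h2.1 k
      have e3 := h1.2 (k + 1)
      have e4 := h2.1 (k + 1)
      rw [inwardShape]
      omega
    exact ⟨fun k => by have := key k; omega, fun k => by have := key k; omega⟩

theorem inwardShape_le_left (hT : IsOscSeq N T) (m p : ℕ) (h : p + m ≤ N) (k : ℕ) :
    inwardShape T m p k ≤ T p k := by
  induction m with
  | zero => exact le_rfl
  | succ m ih => exact ((hT.inwardShape_strip m p (by omega)).1 k).1.trans (ih (by omega))

theorem inwardShape_le_right (hT : IsOscSeq N T) (m p : ℕ) (h : p + m ≤ N) (k : ℕ) :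
    inwardShape T m p k ≤ T (p + m) k := by
  induction m generalizing p with
  | zero => exact le_rfl
  | succ m ih =>
    refine ((hT.inwardShape_strip m p (by omega)).2 k).1.trans ?_
    rw [show p + (m + 1) = p + 1 + m by omega]
    exact ih (p + 1) (by omega)

/-- The filling whose growth diagram has the given boundary. -/
theorem exists_filling (hT : IsOscSeq N T) :
    ∃ x, IsArcFilling N x ∧ ∀ p ≤ N, ∀ k, growthSeq N x p k = T p k := by
  -- `G` is the intended growth diagram, and `X k` the filling its `k`-th row would force; only `X
  -- 0` is the answer, and the `X k` turn out to be its iterated shadows inside the staircase.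
  set G : ℕ → ℕ → ℕ → ℕ := fun k i j => inwardShape T (N - i - j) i k with hG
  set X : ℕ → ℕ → ℕ → ℕ := fun k i j =>
    if N ≤ i + j + 1 then 0 else G k (i + 1) (j + 1) - max (G k i (j + 1)) (G k (i + 1) j) with hX
  have mono : ∀ k i j, i + j + 2 ≤ N →
      max (G k i (j + 1)) (G k (i + 1) j) ≤ G k (i + 1) (j + 1) := by
    intro k i j h
    obtain ⟨m, hm⟩ : ∃ m, N = m + i + j + 2 := ⟨N - i - j - 2, by omega⟩
    have h1 := (hT.inwardShape_strip m i (by omega)).2 k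
    have h2 := (hT.inwardShape_strip m (i + 1) (by omega)).1 k
    simp only [hG]
    rw [show N - i - (j + 1) = m + 1 by omega, show N - (i + 1) - j = m + 1 by omega,
      show N - (i + 1) - (j + 1) = m by omega]
    omega
  have local_rule : ∀ k i j, i + j + 2 ≤ N → G (k + 1) (i + 1) (j + 1) + G k i j =
      max (G (k + 1) i (j + 1)) (G (k + 1) (i + 1) j) + min (G k i (j + 1)) (G k (i + 1) j) := by
    intro k i j h
    obtain ⟨m, hm⟩ : ∃ m, N = m + i + j + 2 := ⟨N - i - j - 2, by omega⟩
    have h1 := (hT.inwardShape_strip m i (by omega)).2 k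
    have h2 := (hT.inwardShape_strip m (i + 1) (by omega)).1 k
    simp only [hG]
    rw [show N - i - (j + 1) = m + 1 by omega, show N - (i + 1) - j = m + 1 by omega,
      show N - (i + 1) - (j + 1) = m by omega, show N - i - j = m + 2 by omega, inwardShape]
    omega
  -- On the axes `G` vanishes, as it is bounded by the empty first and last shapes; elsewhere `X k`
  -- is the increment by definition.
  have hL : ∀ (y : ℕ → ℕ → ℕ) k, (∀ i j, i + j + 2 ≤ N → y i j = X k i j) →
      ∀ i j, i + j ≤ N → chainLen y i j = G k i j := by
    intro y k hy i
    induction i with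
    | zero =>
      intro j hj
      have := hT.inwardShape_le_left (N - 0 - j) 0 (by omega) k
      rw [hT.start] at this
      simp only [chainLen_zero_left, hG]
      omega
    | succ i ih =>
      intro j
      induction j with
      | zero =>
        intro hj
        have := hT.inwardShape_le_right (N - (i + 1) - 0) (i + 1) (by omega) k
        rw [show i + 1 + (N - (i + 1) - 0) = N by omega, hT.finish] at this
        simp only [chainLen_zero_right, hG]
        omega
      | succ j ihj =>
        intro hj
        rw [chainLen_succ_succ, ih _ (by omega), ihj (by omega), hy i j (by omega)]
        simp only [hX]
        rw [if_neg (by omega)]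
        have := mono k i j (by omega)
        omega
  have hiter : ∀ k i j, i + j + 2 ≤ N → (shadow^[k] (X 0)) i j = X k i j := by
    intro k
    induction k with
    | zero => intros; rfl
    | succ k ih =>
      intro i j hij
      rw [Function.iterate_succ_apply', shadow, hL _ k ih _ _ (by omega), hL _ k ih _ _ (by omega),
        hL _ k ih _ _ (by omega)]
      simp only [hX]
      rw [if_neg (by omega)]
      have := local_rule k i j hij
      have := mono (k + 1) i j hij
      omega
  have hgrow : ∀ k i j, i + j ≤ N → growthRow (X 0) k i j = G k i j :=
    fun k => hL _ k (hiter k)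
  have hT' : ∀ p ≤ N, ∀ k, growthSeq N (X 0) p k = T p k := by
    intro p hp k
    rw [growthSeq, hgrow k p (N - p) (by omega)]
    simp only [hG, Nat.sub_self, inwardShape]
  refine ⟨X 0, ⟨fun i j h => if_pos h, fun p hp => ?_⟩, hT'⟩
  -- The row and column sums at `p` are the sizes of `T (p + 1)` and `T p` minus that of their
  -- minimum. One step changes one square, so they add up to 1; `N + 1` rows hold every shape.
  have e1 := sum_growthRow_row (X 0) (K := N + 1) (i := p) (by omega) (N - 1 - p)
  have e2 := sum_growthRow_row (transposeFilling (X 0)) (K := N + 1) (i := N - 1 - p) (by omega) p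
  simp only [growthRow_transposeFilling] at e2
  have b1 : ∀ k, growthRow (X 0) k (p + 1) (N - 1 - p) = T (p + 1) k := fun k => by
    rw [← hT' (p + 1) hp, growthSeq, show N - (p + 1) = N - 1 - p by omega]
  have b2 : ∀ k, growthRow (X 0) k p (N - 1 - p + 1) = T p k := fun k => by
    rw [← hT' p hp.le, growthSeq, show N - p = N - 1 - p + 1 by omega]
  have b3 : ∀ k, growthRow (X 0) k p (N - 1 - p) = min (T p k) (T (p + 1) k) := fun k => by
    rw [hgrow k p _ (by omega)]
    simp only [hG]
    rw [show N - p - (N - 1 - p) = 1 by omega, inwardShape]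
  simp only [b1, b2, b3] at e1 e2
  simp only [transposeFilling] at e2
  have hsum : ∀ f g : ℕ → ℕ, AddsOne f g → (∀ k, N + 1 ≤ k → g k = 0) →
      ∑ k ∈ range (N + 1), g k = ∑ k ∈ range (N + 1), f k + 1 ∧ ∀ k, f k ≤ g k := by
    rintro f g ⟨k, hk⟩ hg
    refine ⟨?_, fun l => by rw [hk l]; omega⟩
    simp only [hk, sum_add_distrib, sum_ite_eq', mem_range]
    rw [if_pos]
    by_contra hcon
    have h1 := hk k
    have h2 := hg k (by omega)
    rw [if_pos rfl] at h1
    omega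
  rcases hT.step p hp with h | h
  · obtain ⟨h1, h2⟩ := hsum _ _ h fun k hk => hT.eq_zero_of_le (p := p + 1) hp (by omega)
    simp only [min_eq_left (h2 _)] at e1 e2
    omega
  · obtain ⟨h1, h2⟩ := hsum _ _ h fun k hk => hT.eq_zero_of_le (p := p) hp.le (by omega)
    simp only [min_eq_right (h2 _)] at e1 e2
    omega

end IsOscSeq

end inverse

/-! ### Young diagrams as row-length sequences -/

section YoungDiagram

theorem youngDiagram_ext {μ ν : YoungDiagram} (h : ∀ k, μ.rowLen k = ν.rowLen k) : μ = ν := by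
  apply YoungDiagram.ext
  ext ⟨i, j⟩
  rw [YoungDiagram.mem_cells, YoungDiagram.mem_cells, YoungDiagram.mem_iff_lt_rowLen,
    YoungDiagram.mem_iff_lt_rowLen, h]

theorem exists_rowLen_eq {f : ℕ → ℕ} (hf : Antitone f) {K : ℕ} (hK : f K = 0) :
    ∃ μ : YoungDiagram, ∀ k, μ.rowLen k = f k := by
  obtain ⟨S, hS⟩ : ∃ S : Finset (ℕ × ℕ), ∀ c, c ∈ S ↔ c.2 < f c.1 := by
    refine ⟨(range K ×ˢ range (f 0)).filter (fun c => c.2 < f c.1), fun c => ?_⟩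
    rw [mem_filter, mem_product, mem_range, mem_range]
    refine ⟨fun h => h.2, fun h => ⟨⟨?_, h.trans_le (hf (Nat.zero_le _))⟩, h⟩⟩
    by_contra hcon
    have := hf (not_lt.1 hcon)
    omega
  have hlow : IsLowerSet (S : Set (ℕ × ℕ)) := by
    intro a b hab ha
    rw [mem_coe, hS] at ha ⊢
    exact (lt_of_le_of_lt hab.2 ha).trans_le (hf hab.1)
  refine ⟨⟨S, hlow⟩, fun k => eq_of_forall_lt_iff fun j => ?_⟩
  rw [← YoungDiagram.mem_iff_lt_rowLen, YoungDiagram.mem_mk, hS]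

theorem rowLen_eq_zero_iff {μ : YoungDiagram} {d : ℕ} : μ.rowLen d = 0 ↔ μ.colLen 0 ≤ d := by
  rw [← not_iff_not, not_le, ← YoungDiagram.mem_iff_lt_colLen, YoungDiagram.mem_iff_lt_rowLen]
  omega

theorem rowLen_bot (k : ℕ) : (⊥ : YoungDiagram).rowLen k = 0 := by
  by_contra h
  have := YoungDiagram.mem_iff_lt_rowLen.2 (Nat.pos_of_ne_zero h)
  exact YoungDiagram.notMem_bot _ this

theorem addsSquare_iff {μ ν : YoungDiagram} : AddsSquare μ ν ↔ AddsOne μ.rowLen ν.rowLen := by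
  constructor
  · rintro ⟨⟨i, j⟩, hc, h⟩
    refine ⟨i, fun l => ?_⟩
    rw [YoungDiagram.rowLen_eq_card, YoungDiagram.rowLen_eq_card, YoungDiagram.row,
      YoungDiagram.row, h, filter_insert]
    by_cases hl : l = i
    · subst hl
      rw [if_pos rfl, if_pos rfl, card_insert_of_notMem]
      simp [hc]
    · rw [if_neg (fun h => hl h.symm), if_neg hl, add_zero]
  · rintro ⟨i, hi⟩
    -- The only cell that can lengthen row `i` by one is its first free cell.
    refine ⟨(i, μ.rowLen i), ?_, ?_⟩
    · rw [YoungDiagram.mem_cells, YoungDiagram.mem_iff_lt_rowLen]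
      exact lt_irrefl _
    · ext ⟨a, b⟩
      rw [mem_insert, YoungDiagram.mem_cells, YoungDiagram.mem_cells,
        YoungDiagram.mem_iff_lt_rowLen, YoungDiagram.mem_iff_lt_rowLen, hi a, Prod.mk.injEq]
      by_cases ha : a = i
      · subst ha; rw [if_pos rfl]; omega
      · rw [if_neg ha]; omega

theorem addsSquare_transpose {μ ν : YoungDiagram} (h : AddsSquare μ ν) :
    AddsSquare μ.transpose ν.transpose := by
  obtain ⟨c, hc, h⟩ := h
  refine ⟨c.swap, ?_, ?_⟩
  · rw [YoungDiagram.mem_cells, YoungDiagram.mem_transpose, Prod.swap_swap]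
    exact hc
  · ext a
    rw [mem_insert, YoungDiagram.mem_cells, YoungDiagram.mem_cells, YoungDiagram.mem_transpose,
      YoungDiagram.mem_transpose, ← YoungDiagram.mem_cells, h, mem_insert,
      YoungDiagram.mem_cells, Prod.swap_eq_iff_eq_swap]

/-- The Young diagram with the given row lengths, if there is one. -/
noncomputable def ofRowLen (f : ℕ → ℕ) : YoungDiagram :=
  open Classical in if h : ∃ μ : YoungDiagram, ∀ k, μ.rowLen k = f k then h.choose else ⊥

theorem rowLen_ofRowLen {f : ℕ → ℕ} (h : ∃ μ : YoungDiagram, ∀ k, μ.rowLen k = f k) (k : ℕ) :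
    (ofRowLen f).rowLen k = f k := by
  rw [ofRowLen, dif_pos h]
  exact h.choose_spec k

end YoungDiagram

/-! ### Matchings as fillings of the staircase -/

section Matching

variable {n : ℕ} {M : SetPartition n}

theorem IsMatching.exists_partner (hM : IsMatching M) (p : Fin (2 * n)) :
    ∃ q, q ≠ p ∧ {p, q} ∈ M.parts := by
  obtain ⟨t, ht, hp⟩ := M.exists_mem (mem_univ p)
  obtain ⟨a, b, hab, rfl⟩ := card_eq_two.1 (hM t ht)
  rw [mem_insert, mem_singleton] at hp
  rcases hp with rfl | rfl
  · exact ⟨b, hab.symm, ht⟩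
  · exact ⟨a, hab, by rwa [pair_comm]⟩

theorem partner_unique {p q q' : Fin (2 * n)} (h : {p, q} ∈ M.parts) (h' : {p, q'} ∈ M.parts)
    (hq : q ≠ p) : q = q' := by
  have h1 := M.eq_of_mem_parts h h' (a := p) (by simp) (by simp)
  have h2 : q ∈ ({p, q'} : Finset (Fin (2 * n))) := h1 ▸ (by simp)
  rw [mem_insert, mem_singleton] at h2
  exact h2.resolve_left hq

/-- The filling of the staircase recording the arcs of `M`. -/
noncomputable def arcFilling (M : SetPartition n) (i j : ℕ) : ℕ :=
  open Classical in
  if ∃ a b : Fin (2 * n), IsArc M a b ∧ a.val = i ∧ b.val + j + 1 = 2 * n then 1 else 0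

theorem arcFilling_ne_zero_iff {i j : ℕ} : arcFilling M i j ≠ 0 ↔
    ∃ a b : Fin (2 * n), IsArc M a b ∧ a.val = i ∧ b.val + j + 1 = 2 * n := by
  rw [arcFilling]; split_ifs with h <;> simp [h]

theorem arcFilling_le_one (i j : ℕ) : arcFilling M i j ≤ 1 := by
  rw [arcFilling]; split_ifs <;> omega

theorem arcFilling_rev_ne_zero_iff {a b : Fin (2 * n)} :
    arcFilling M a b.rev ≠ 0 ↔ IsArc M a b := by
  rw [arcFilling_ne_zero_iff]
  constructor
  · rintro ⟨a', b', h, ha, hb⟩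
    rw [Fin.val_rev] at hb
    obtain rfl : a' = a := Fin.ext ha
    obtain rfl : b' = b := Fin.ext (by omega)
    exact h
  · intro h
    exact ⟨a, b, h, rfl, by rw [Fin.val_rev]; omega⟩

theorem IsMatching.isArcFilling (hM : IsMatching M) : IsArcFilling (2 * n) (arcFilling M) := by
  constructor
  · intro i j hij
    by_contra h
    obtain ⟨a, b, hab, rfl, hb⟩ := arcFilling_ne_zero_iff.1 h
    have := hab.1
    rw [Fin.lt_def] at this
    omega
  · intro p hp
    obtain ⟨q, hq, hpq⟩ := hM.exists_partner ⟨p, hp⟩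
    rcases lt_or_gt_of_ne hq with hlt | hlt
    · have hne : arcFilling M q (2 * n - 1 - p) ≠ 0 := arcFilling_ne_zero_iff.2
        ⟨q, ⟨p, hp⟩, ⟨hlt, by rwa [pair_comm]⟩, rfl, by simp only; omega⟩
      have h1 := arcFilling_le_one (M := M) q (2 * n - 1 - p)
      rw [sum_eq_zero, sum_eq_single q.val]
      · omega
      · intro a ha haq
        by_contra h
        obtain ⟨a', b, hab, rfl, hb⟩ := arcFilling_ne_zero_iff.1 h
        obtain rfl : b = ⟨p, hp⟩ := Fin.ext (by simp only; omega)
        have h2 := hab.2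
        rw [pair_comm] at h2
        exact haq (congrArg Fin.val (partner_unique h2 hpq hab.1.ne))
      · intro h
        exact absurd (mem_range.2 hlt) h
      · intro b hb
        by_contra h
        obtain ⟨a', b', hab, ha, hb⟩ := arcFilling_ne_zero_iff.1 h
        obtain rfl : a' = ⟨p, hp⟩ := Fin.ext ha
        have := partner_unique hab.2 hpq hab.1.ne'
        subst this
        exact lt_asymm hab.1 hlt
    · have hlt' : p < q.val := hlt
      have hne : arcFilling M p (2 * n - 1 - q) ≠ 0 := arcFilling_ne_zero_iff.2
        ⟨⟨p, hp⟩, q, ⟨hlt, hpq⟩, rfl, by omega⟩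
      have h1 := arcFilling_le_one (M := M) p (2 * n - 1 - q)
      rw [sum_eq_single (2 * n - 1 - q.val), sum_eq_zero]
      · omega
      · intro a ha
        by_contra h
        obtain ⟨a', b', hab, rfl, hb⟩ := arcFilling_ne_zero_iff.1 h
        obtain rfl : b' = ⟨p, hp⟩ := Fin.ext (by simp only; omega)
        have h2 := hab.2
        rw [pair_comm] at h2
        have := partner_unique h2 hpq hab.1.ne
        subst this
        exact lt_asymm hab.1 hlt
      · intro b hb hbq
        by_contra h
        obtain ⟨a', b', hab, ha, hb⟩ := arcFilling_ne_zero_iff.1 h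
        obtain rfl : a' = ⟨p, hp⟩ := Fin.ext ha
        have := partner_unique hab.2 hpq hab.1.ne'
        subst this
        omega
      · intro h
        refine absurd (mem_range.2 ?_) h
        omega

theorem IsMatching.eq_of_arcFilling_eq {M' : SetPartition n} (hM : IsMatching M)
    (hM' : IsMatching M') (h : arcFilling M = arcFilling M') : M = M' := by
  have key : ∀ M M' : SetPartition n, IsMatching M → arcFilling M = arcFilling M' →
      M.parts ⊆ M'.parts := by
    intro M M' hM h s hs
    obtain ⟨a, b, hab, rfl⟩ := card_eq_two.1 (hM s hs)
    rcases lt_or_gt_of_ne hab with hlt | hlt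
    · have h1 := arcFilling_rev_ne_zero_iff.2 (show IsArc M a b from ⟨hlt, hs⟩)
      rw [h] at h1
      exact (arcFilling_rev_ne_zero_iff.1 h1).2
    · rw [pair_comm] at hs ⊢
      have h1 := arcFilling_rev_ne_zero_iff.2 (show IsArc M b a from ⟨hlt, hs⟩)
      rw [h] at h1
      exact (arcFilling_rev_ne_zero_iff.1 h1).2
  exact Finpartition.ext ((key M M' hM h).antisymm (key M' M hM' h.symm))

theorem IsArcFilling.exists_partner {N : ℕ} {x : ℕ → ℕ → ℕ} (hx : IsArcFilling N x)
    (p : Fin N) : ∃ q : Fin N, (p < q ∧ x p q.rev ≠ 0) ∨ (q < p ∧ x q p.rev ≠ 0) := by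
  by_contra! h
  have h1 := hx.one p p.isLt
  rw [sum_eq_zero, sum_eq_zero] at h1
  · omega
  · intro a ha
    rw [mem_range] at ha
    have := (h ⟨a, ha.trans p.isLt⟩).2 ha
    rw [Fin.val_rev] at this
    rwa [show N - 1 - p.val = N - (p.val + 1) by omega]
  · intro b hb
    rw [mem_range] at hb
    have := (h ⟨N - 1 - b, by omega⟩).1 (by rw [Fin.lt_def]; simp only; omega)
    rw [Fin.val_rev] at this
    rwa [show N - (N - 1 - b + 1) = b by omega] at this

theorem IsArcFilling.exists_matching {x : ℕ → ℕ → ℕ} (hx : IsArcFilling (2 * n) x) :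
    ∃ M : SetPartition n, IsMatching M ∧ arcFilling M = x := by
  classical
  set A : Finset (Fin (2 * n) × Fin (2 * n)) :=
    univ.filter fun p => p.1 < p.2 ∧ x p.1 p.2.rev ≠ 0 with hA
  have hmemA : ∀ a b, (a, b) ∈ A ↔ a < b ∧ x a b.rev ≠ 0 := by simp [hA]
  set P : Finset (Finset (Fin (2 * n))) := A.image fun p => {p.1, p.2} with hP
  have hP2 : ∀ t ∈ P, ∃ a b : Fin (2 * n), a < b ∧ x a b.rev ≠ 0 ∧ t = {a, b} := by
    intro t ht
    obtain ⟨⟨a, b⟩, hab, rfl⟩ := mem_image.1 ht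
    exact ⟨a, b, ((hmemA a b).1 hab).1, ((hmemA a b).1 hab).2, rfl⟩
  have hpp := hx.isPartialPerm
  have hcol := hpp.transposeFilling
  have hrev : ∀ a b : Fin (2 * n), a.rev.val = b.rev.val → a = b := fun a b h =>
    Fin.rev_injective (Fin.ext h)
  -- A point closing one arc and opening another would have row sum plus column sum at least 2. The
  -- other overlaps of two arcs are excluded by uniqueness in rows and columns.
  have hcross : ∀ a b c : Fin (2 * n), a < b → b < c → x a b.rev ≠ 0 → x b c.rev ≠ 0 → False := by
    intro a b c hab hbc h1 h2
    have h3 := hx.one b b.isLt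
    rw [Fin.val_rev] at h1 h2
    have h4 : x b (2 * n - (c + 1)) ≤ ∑ j ∈ range (2 * n - 1 - b), x b j :=
      single_le_sum (f := fun j => x b j) (fun _ _ => Nat.zero_le _)
        (mem_range.2 (by rw [Fin.lt_def] at hbc; omega))
    have h5 : x a (2 * n - 1 - b) ≤ ∑ i ∈ range b, x i (2 * n - 1 - b) :=
      single_le_sum (f := fun i => x i (2 * n - 1 - b)) (fun _ _ => Nat.zero_le _)
        (mem_range.2 hab)
    rw [show 2 * n - (b.val + 1) = 2 * n - 1 - b by omega] at h1
    omega
  have huniq : ∀ t ∈ P, ∀ u ∈ P, ∀ p, p ∈ t → p ∈ u → t = u := by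
    intro t ht u hu p hpt hpu
    obtain ⟨a, b, hab, hx1, rfl⟩ := hP2 t ht
    obtain ⟨c, d, hcd, hx2, rfl⟩ := hP2 u hu
    rw [mem_insert, mem_singleton] at hpt hpu
    rcases hpt with rfl | rfl <;> rcases hpu with rfl | rfl
    · rw [hrev _ _ (hpp.row_unique hx1 hx2)]
    · exact (hcross _ _ _ hcd hab hx2 hx1).elim
    · exact (hcross _ _ _ hab hcd hx1 hx2).elim
    · rw [Fin.ext (hcol.row_unique (i := Fin.val (Fin.rev p)) (j := a) (j' := c) hx1 hx2)]
  set M : SetPartition n := Finpartition.ofExistsUnique P (fun _ _ => subset_univ _)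
    (fun p _ => by
      obtain ⟨q, hq⟩ := hx.exists_partner p
      have : ∃ t ∈ P, p ∈ t := by
        rcases hq with hq | hq
        · exact ⟨{p, q}, mem_image.2 ⟨(p, q), (hmemA _ _).2 hq, rfl⟩, by simp⟩
        · exact ⟨{q, p}, mem_image.2 ⟨(q, p), (hmemA _ _).2 hq, rfl⟩, by simp⟩
      obtain ⟨t, ht, hpt⟩ := this
      exact ⟨t, ⟨ht, hpt⟩, fun u hu => huniq u hu.1 t ht p hu.2 hpt⟩)
    (fun h => by
      obtain ⟨a, b, -, -, h⟩ := hP2 _ h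
      exact (insert_ne_empty _ _ h.symm)) with hM
  have hparts : M.parts = P := rfl
  have hMatch : IsMatching M := by
    intro t ht
    obtain ⟨a, b, hab, -, rfl⟩ := hP2 t ht
    exact card_pair hab.ne
  refine ⟨M, hMatch, ?_⟩
  have hmf := hMatch.isArcFilling
  have hle : ∀ i j, x i j ≤ 1 := fun i j =>
    (single_le_sum (f := fun b => x i b) (fun _ _ => Nat.zero_le _)
      (mem_range.2 (Nat.lt_succ_self j))).trans (hpp.row i (j + 1))
  funext i j
  by_cases hij : 2 * n ≤ i + j + 1
  · rw [hx.zero i j hij, hmf.zero i j hij]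
  · have hiff : arcFilling M i j ≠ 0 ↔ x i j ≠ 0 := by
      rw [arcFilling_ne_zero_iff]
      constructor
      · rintro ⟨a, b, ⟨hab, hmem⟩, rfl, hb⟩
        obtain ⟨c, d, hcd, hx1, he⟩ := hP2 _ hmem
        have hac : a = c ∧ b = d := by
          have ha : a ∈ ({c, d} : Finset _) := he ▸ (by simp)
          have hb : b ∈ ({c, d} : Finset _) := he ▸ (by simp)
          rw [mem_insert, mem_singleton] at ha hb
          rcases ha with rfl | rfl <;> rcases hb with rfl | rfl
          · exact absurd hab (lt_irrefl _)
          · exact ⟨rfl, rfl⟩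
          · exact absurd hab hcd.asymm
          · exact absurd hab (lt_irrefl _)
        obtain ⟨rfl, rfl⟩ := hac
        rwa [show j = b.rev.val by rw [Fin.val_rev]; omega]
      · intro h
        refine ⟨⟨i, by omega⟩, ⟨2 * n - 1 - j, by omega⟩, ⟨?_, ?_⟩, rfl, by simp only; omega⟩
        · rw [Fin.lt_def]; simp only; omega
        · rw [hparts]
          refine mem_image.2 ⟨(⟨i, by omega⟩, ⟨2 * n - 1 - j, by omega⟩), (hmemA _ _).2 ⟨?_, ?_⟩, rfl⟩
          · rw [Fin.lt_def]; simp only; omega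
          · rw [Fin.val_rev]; simp only
            rwa [show 2 * n - (2 * n - 1 - j + 1) = j by omega]
    have h1 := hle i j
    have h2 := arcFilling_le_one (M := M) i j
    omega

/-- Reflection takes the arc `(a, b)` to `(b.rev, a.rev)`. Since closers are recorded in reversed
order, this moves the cell `(a, b.rev)` to `(b.rev, a)`. -/
theorem IsMatching.isBilaterallySymmetric_iff (hM : IsMatching M) :
    IsBilaterallySymmetric M ↔ transposeFilling (arcFilling M) = arcFilling M := by
  have hinv : ∀ b : Finset (Fin (2 * n)), (b.image Fin.rev).image Fin.rev = b := fun b => by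
    rw [image_image, Fin.rev_involutive.comp_self, image_id]
  have hsub : IsBilaterallySymmetric M ↔ ∀ b ∈ M.parts, b.image Fin.rev ∈ M.parts := by
    constructor
    · intro h b hb
      rw [← h]
      exact mem_image_of_mem _ hb
    · intro h
      apply Subset.antisymm
      · intro b hb
        obtain ⟨c, hc, rfl⟩ := mem_image.1 hb
        exact h c hc
      · intro b hb
        exact mem_image.2 ⟨_, h b hb, hinv b⟩
  have harc : (∀ b ∈ M.parts, b.image Fin.rev ∈ M.parts) ↔
      ∀ a b, IsArc M a b → IsArc M b.rev a.rev := by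
    constructor
    · intro h a b hab
      have := h _ hab.2
      rw [image_insert, image_singleton, pair_comm] at this
      exact ⟨Fin.rev_lt_rev.2 hab.1, this⟩
    · intro h s hs
      obtain ⟨a, b, hab, rfl⟩ := card_eq_two.1 (hM s hs)
      rw [image_insert, image_singleton]
      rcases lt_or_gt_of_ne hab with hlt | hlt
      · rw [pair_comm]
        exact (h a b ⟨hlt, hs⟩).2
      · exact (h b a ⟨hlt, by rwa [pair_comm]⟩).2
  rw [hsub, harc]
  constructor
  · intro h
    have key : ∀ i j, arcFilling M i j ≠ 0 → arcFilling M j i ≠ 0 := by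
      intro i j hij
      obtain ⟨a, b, hab, rfl, hb⟩ := arcFilling_ne_zero_iff.1 hij
      exact arcFilling_ne_zero_iff.2 ⟨_, _, h a b hab, by rw [Fin.val_rev]; omega,
        by rw [Fin.val_rev]; omega⟩
    funext i j
    rw [transposeFilling]
    have := key i j
    have := key j i
    have := arcFilling_le_one (M := M) i j
    have := arcFilling_le_one (M := M) j i
    omega
  · intro h a b hab
    rw [← arcFilling_rev_ne_zero_iff, Fin.rev_rev]
    have := arcFilling_rev_ne_zero_iff.2 hab
    rw [← h] at this
    exact this

/-- Columns number the closers from the right, so increasing closers become decreasing columns. The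
rectangle at `p` holds the arcs opened before `p` and closed at `p` or later, which encodes that
every opener precedes every closer; one takes `p` just after the last opener. -/
theorem hasCrossing_iff (d : ℕ) : HasCrossing (d + 1) M ↔
    ∃ p ≤ 2 * n, HasAntichain (arcFilling M) (d + 1) p (2 * n - p) := by
  constructor
  · rintro ⟨a, b, ha, hb, hlt, harc⟩
    refine ⟨a (Fin.last d) + 1, (a (Fin.last d)).isLt, fun r => a r, fun r => (b r).rev, ha,
      fun r s hrs => Fin.rev_lt_rev.2 (hb hrs), fun r =>
        ⟨Nat.lt_succ_of_le (ha.monotone (Fin.le_last r)), ?_, arcFilling_rev_ne_zero_iff.2 (harc r)⟩⟩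
    have := hlt (Fin.last d) r
    rw [Fin.lt_def] at this
    simp only [Fin.val_rev]
    omega
  · rintro ⟨p, hp, a, b, ha, hb, hab⟩
    choose h1 h2 h3 using hab
    have h4 := fun r => arcFilling_ne_zero_iff.1 (h3 r)
    choose A B hAB hA hB using h4
    refine ⟨A, B, fun r s hrs => ?_, fun r s hrs => ?_, fun r s => ?_, hAB⟩
    · rw [Fin.lt_def, hA, hA]; exact ha hrs
    · have := hb hrs
      have := hB r
      have := hB s
      rw [Fin.lt_def]; omega
    · have := h1 r
      have := h2 s
      have := hA r
      have := hB s
      rw [Fin.lt_def]; omega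

/-- The same dictionary: the decreasing closers of a nesting become increasing columns. -/
theorem hasNesting_iff (d : ℕ) : HasNesting (d + 1) M ↔
    ∃ p ≤ 2 * n, HasChain (arcFilling M) (d + 1) p (2 * n - p) := by
  constructor
  · rintro ⟨a, b, ha, hb, hlt, harc⟩
    refine ⟨a (Fin.last d) + 1, (a (Fin.last d)).isLt, fun r => a r, fun r => (b r).rev, ha,
      fun r s hrs => Fin.rev_lt_rev.2 (hb hrs), fun r =>
        ⟨Nat.lt_succ_of_le (ha.monotone (Fin.le_last r)), ?_, arcFilling_rev_ne_zero_iff.2 (harc r)⟩⟩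
    have := hlt (Fin.last d) r
    rw [Fin.lt_def] at this
    simp only [Fin.val_rev]
    omega
  · rintro ⟨p, hp, a, b, ha, hb, hab⟩
    choose h1 h2 h3 using hab
    have h4 := fun r => arcFilling_ne_zero_iff.1 (h3 r)
    choose A B hAB hA hB using h4
    refine ⟨A, B, fun r s hrs => ?_, fun r s hrs => ?_, fun r s => ?_, hAB⟩
    · rw [Fin.lt_def, hA, hA]; exact ha hrs
    · have := hb hrs
      have := hB r
      have := hB s
      rw [Fin.lt_def]; omega
    · have := h1 r
      have := h2 s
      have := hA r
      have := hB s
      rw [Fin.lt_def]; omega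

end Matching

/-! ### Palindromic paths, and diagrams as chamber points -/

section Path

variable {α β : Type*}

/-- The sequences `w_0, …, w_m` of elements satisfying `P`, with `w_0 = a` and with consecutive
elements related by `R`. -/
def pathSet (R : α → α → Prop) (P : α → Prop) (m : ℕ) (a : α) : Set (Fin (m + 1) → α) :=
  {w | w 0 = a ∧ (∀ i, P (w i)) ∧ ∀ i : Fin m, R (w i.castSucc) (w i.succ)}

/-- The palindromic paths of length `2 n` correspond to the paths of length `n`. -/
theorem encard_palindromic_pathSet {R : α → α → Prop} (hR : ∀ x y, R x y → R y x) (P : α → Prop)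
    (n : ℕ) (a : α) :
    {w | w ∈ pathSet R P (2 * n) a ∧ IsPalindromic w}.encard = (pathSet R P n a).encard := by
  refine Set.encard_congr (Set.BijOn.equiv
    (fun w (i : Fin (n + 1)) => w ⟨i, by omega⟩) ⟨?_, ?_, ?_⟩)
  · rintro w ⟨⟨h0, hP, hstep⟩, -⟩
    exact ⟨h0, fun i => hP _, fun i => hstep ⟨i, by omega⟩⟩
  · rintro w ⟨-, hw⟩ w' ⟨-, hw'⟩ h
    have hlow : ∀ i : Fin (2 * n + 1), i.val ≤ n → w i = w' i := fun i hi =>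
      congrFun h ⟨i, by omega⟩
    funext i
    by_cases hi : i.val ≤ n
    · exact hlow i hi
    · rw [hw, hw']
      exact hlow i.rev (by rw [Fin.val_rev]; omega)
  · rintro v ⟨h0, hP, hstep⟩
    -- The half path is run forwards and then backwards; the way back needs the symmetry `hR`.
    refine ⟨fun i => v ⟨min i (2 * n - i), by omega⟩, ⟨⟨?_, fun i => hP _, fun i => ?_⟩, ?_⟩, ?_⟩
    · rw [← h0]
      congr 1
    · by_cases hi : i.val < n
      · have := hstep ⟨i, hi⟩
        convert this using 3
        · simp; omega
        · simp; omega
      · have := hR _ _ (hstep ⟨2 * n - 1 - i, by omega⟩)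
        convert this using 3
        · simp; omega
        · simp; omega
    · funext i
      rw [reversal]
      congr 1
      ext
      simp only [Fin.val_rev]
      omega
    · funext i
      refine congrArg v (Fin.ext ?_)
      simp only
      omega

/-- Transport of paths along a bijection. -/
theorem encard_pathSet_congr {R : α → α → Prop} {P : α → Prop} {R' : β → β → Prop}
    {P' : β → Prop} {φ : α → β} (hφ : Set.BijOn φ {x | P x} {y | P' y})
    (hR : ∀ x y, P x → P y → (R x y ↔ R' (φ x) (φ y))) (m : ℕ) {a : α} (ha : P a) :
    (pathSet R P m a).encard = (pathSet R' P' m (φ a)).encard := by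
  refine Set.encard_congr (Set.BijOn.equiv (fun w i => φ (w i)) ⟨?_, ?_, ?_⟩)
  · rintro w ⟨h0, hP, hstep⟩
    exact ⟨congrArg φ h0, fun i => hφ.mapsTo (hP i), fun i => (hR _ _ (hP _) (hP _)).1 (hstep i)⟩
  · rintro w ⟨-, hP, -⟩ w' ⟨-, hP', -⟩ h
    funext i
    exact hφ.injOn (hP i) (hP' i) (congrFun h i)
  · rintro v ⟨h0, hP, hstep⟩
    choose w hw hwv using fun i => hφ.surjOn (hP i)
    refine ⟨w, ⟨hφ.injOn (hw 0) ha ((hwv 0).trans h0), hw, fun i => ?_⟩, funext hwv⟩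
    rw [hR _ _ (hw _) (hw _), hwv, hwv]
    exact hstep i

end Path

/-- Two Young diagrams which differ by one square. -/
def YoungStep (μ ν : YoungDiagram) : Prop := AddsSquare μ ν ∨ AddsSquare ν μ

theorem YoungStep.symm {μ ν : YoungDiagram} (h : YoungStep μ ν) : YoungStep ν μ := Or.symm h

/-- Two lattice points which differ by a unit coordinate vector. -/
def LatticeStep {d : ℕ} (x y : Fin d → ℤ) : Prop :=
  ∃ k : Fin d, y = x + Pi.single k 1 ∨ y = x - Pi.single k 1

theorem LatticeStep.symm {d : ℕ} {x y : Fin d → ℤ} (h : LatticeStep x y) : LatticeStep y x := by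
  obtain ⟨k, rfl | rfl⟩ := h
  · exact ⟨k, Or.inr (by simp)⟩
  · exact ⟨k, Or.inl (by simp)⟩

theorem palindromicWalks_eq (d n : ℕ) : palindromicWalks d n =
    {w | w ∈ pathSet LatticeStep (· ∈ weylChamber d) (2 * n) (weylDelta d) ∧ IsPalindromic w} := by
  ext w
  exact ⟨fun ⟨⟨h1, h2, h3⟩, h4⟩ => ⟨⟨h1, h2, h3⟩, h4⟩, fun ⟨⟨h1, h2, h3⟩, h4⟩ => ⟨⟨h1, h2, h3⟩, h4⟩⟩

theorem boundedTableaux_eq (d n : ℕ) : boundedTableaux d n =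
    pathSet YoungStep (fun μ => μ.colLen 0 ≤ d) n ⊥ := by
  ext w
  exact ⟨fun ⟨⟨_, h1, _, h2⟩, h3⟩ => ⟨h1, h3, h2⟩, fun ⟨h1, h3, h2⟩ => ⟨⟨_, h1, rfl, h2⟩, h3⟩⟩

theorem palindromic_last {α : Type*} {m : ℕ} {w : Fin (m + 1) → α} (h : IsPalindromic w) :
    w (Fin.last m) = w 0 := by
  rw [h, reversal, Fin.rev_last, ← h]

theorem palindromicTableaux_eq (d n : ℕ) : palindromicTableaux d n =
    {w | w ∈ pathSet YoungStep (fun μ => μ.colLen 0 ≤ d) (2 * n) ⊥ ∧ IsPalindromic w} := by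
  ext w
  exact ⟨fun ⟨⟨h1, _, h2⟩, h3, h4⟩ => ⟨⟨h1, h3, h2⟩, h4⟩,
    fun ⟨⟨h1, h3, h2⟩, h4⟩ => ⟨⟨h1, (palindromic_last h4).trans h1, h2⟩, h3, h4⟩⟩

theorem encard_palindromicWalks (d n : ℕ) : (palindromicWalks d n).encard =
    (pathSet LatticeStep (· ∈ weylChamber d) n (weylDelta d)).encard := by
  rw [palindromicWalks_eq, encard_palindromic_pathSet fun _ _ => LatticeStep.symm]

theorem encard_palindromicTableaux (d n : ℕ) :
    (palindromicTableaux d n).encard = (boundedTableaux d n).encard := by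
  rw [palindromicTableaux_eq, encard_palindromic_pathSet fun _ _ => YoungStep.symm, boundedTableaux_eq]

/-- The lattice point of a Young diagram with at most `d` rows. -/
def latticePoint (d : ℕ) (μ : YoungDiagram) (i : Fin d) : ℤ := μ.rowLen i + (d - i)

theorem latticePoint_bot (d : ℕ) : latticePoint d ⊥ = weylDelta d := by
  funext i
  rw [latticePoint, weylDelta, rowLen_bot]
  simp

theorem rowLen_eq_zero_of_le {μ : YoungDiagram} {d k : ℕ} (h : μ.colLen 0 ≤ d) (hk : d ≤ k) :
    μ.rowLen k = 0 :=
  rowLen_eq_zero_iff.2 (h.trans hk)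

theorem strictAnti_add_le {d : ℕ} {x : Fin d → ℤ} (hx : StrictAnti x) {i j : Fin d} (h : i ≤ j) :
    x j + (j - i) ≤ x i := by
  obtain ⟨m, hm⟩ : ∃ m : ℕ, j.val = i.val + m := ⟨j - i, by rw [Fin.le_def] at h; omega⟩
  induction m generalizing j with
  | zero =>
    obtain rfl : j = i := Fin.ext hm
    simp
  | succ m ih =>
    have h1 := ih (j := ⟨j - 1, by omega⟩) (by rw [Fin.le_def]; simp only; omega)
      (by simp only; omega)
    have h2 : x j < x ⟨j - 1, by omega⟩ := hx (by rw [Fin.lt_def]; simp only; omega)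
    simp only at h1
    omega

/-- Adding $(d,\dots,1)$ makes weakly decreasing nonnegative sequences strictly decreasing and
positive, and every chamber point dominates $(d,\dots,1)$, so it can be subtracted again. -/
theorem bijOn_latticePoint (d : ℕ) :
    Set.BijOn (latticePoint d) {μ | μ.colLen 0 ≤ d} {x | x ∈ weylChamber d} := by
  refine ⟨fun μ _ => ⟨fun i j hij => ?_, fun i => ?_⟩, fun μ hμ ν hν h => ?_, fun x hx => ?_⟩
  · have h1 := μ.rowLen_anti i j hij.le
    rw [Fin.lt_def] at hij
    simp only [latticePoint]
    omega
  · have := i.isLt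
    simp only [latticePoint]
    omega
  · refine youngDiagram_ext fun k => ?_
    by_cases hk : k < d
    · have := congrFun h ⟨k, hk⟩
      simp only [latticePoint] at this
      omega
    · rw [rowLen_eq_zero_of_le hμ (not_lt.1 hk), rowLen_eq_zero_of_le hν (not_lt.1 hk)]
  · obtain ⟨hanti, hpos⟩ := hx
    have hge : ∀ i : Fin d, (d : ℤ) - i ≤ x i := by
      intro i
      have hi := i.isLt
      have h1 := hpos ⟨d - 1, by omega⟩
      have h2 := strictAnti_add_le hanti (i := i) (j := ⟨d - 1, by omega⟩)
        (by rw [Fin.le_def]; simp only; omega)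
      simp only at h2
      omega
    obtain ⟨μ, hμ⟩ := exists_rowLen_eq
      (f := fun k => if h : k < d then (x ⟨k, h⟩ - (d - k)).toNat else 0) (K := d) (by
        intro a b hab
        simp only
        split_ifs with h1 h2
        · have := strictAnti_add_le hanti (i := ⟨a, h2⟩) (j := ⟨b, h1⟩) hab
          simp only at this
          omega
        · omega
        · omega
        · omega) (by simp)
    refine ⟨μ, ?_, ?_⟩
    · rw [Set.mem_ofPred_eq, ← rowLen_eq_zero_iff, hμ]
      simp
    · funext i
      have := hge i
      rw [latticePoint, hμ, dif_pos i.isLt]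
      simp only [Fin.eta]
      omega

theorem addsSquare_iff_latticePoint {d : ℕ} {μ ν : YoungDiagram} (hμ : μ.colLen 0 ≤ d)
    (hν : ν.colLen 0 ≤ d) : AddsSquare μ ν ↔
      ∃ k : Fin d, latticePoint d ν = latticePoint d μ + Pi.single k 1 := by
  rw [addsSquare_iff]
  constructor
  · rintro ⟨k, hk⟩
    have hkd : k < d := by
      by_contra h
      have h1 := hk k
      rw [rowLen_eq_zero_of_le hν (not_lt.1 h), if_pos rfl] at h1
      omega
    refine ⟨⟨k, hkd⟩, funext fun i => ?_⟩
    have := hk i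
    simp only [Pi.add_apply, Pi.single_apply, latticePoint, this, Fin.ext_iff]
    split_ifs <;> push_cast <;> ring
  · rintro ⟨k, hk⟩
    refine ⟨k, fun l => ?_⟩
    by_cases hl : l < d
    · have := congrFun hk ⟨l, hl⟩
      simp only [Pi.add_apply, Pi.single_apply, latticePoint, Fin.ext_iff] at this
      split_ifs at this ⊢ <;> omega
    · rw [rowLen_eq_zero_of_le hμ (not_lt.1 hl), rowLen_eq_zero_of_le hν (not_lt.1 hl),
        if_neg (by have := k.isLt; omega)]

theorem encard_boundedTableaux (d n : ℕ) : (boundedTableaux d n).encard =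
    (pathSet LatticeStep (· ∈ weylChamber d) n (weylDelta d)).encard := by
  rw [boundedTableaux_eq, ← latticePoint_bot]
  refine encard_pathSet_congr (bijOn_latticePoint d) (fun μ ν hμ hν => ?_) n ?_
  · rw [YoungStep, addsSquare_iff_latticePoint hμ hν, addsSquare_iff_latticePoint hν hμ,
      LatticeStep, ← exists_or]
    simp only [eq_sub_iff_add_eq, eq_comm (a := latticePoint d μ)]
  · rw [← rowLen_eq_zero_iff, rowLen_bot]

/-! ### Symmetric matchings and palindromic tableaux -/

section Matching

variable {n : ℕ}

/-- The oscillating tableau of a matching. -/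
noncomputable def tableauOfMatching (M : SetPartition n) (p : Fin (2 * n + 1)) : YoungDiagram :=
  ofRowLen (growthSeq (2 * n) (arcFilling M) p)

theorem IsMatching.rowLen_tableau {M : SetPartition n} (hM : IsMatching M) (p : Fin (2 * n + 1))
    (k : ℕ) : (tableauOfMatching M p).rowLen k = growthSeq (2 * n) (arcFilling M) p k := by
  have h := hM.isArcFilling.isOscSeq
  exact rowLen_ofRowLen (exists_rowLen_eq (h.anti p (by omega))
    (h.eq_zero_of_le (p := p) (by omega) le_rfl)) k

/-- The boundary of the growth diagram determines the filling, hence the matching, and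
`exists_filling` with `exists_matching` inverts this. Symmetric matchings are symmetric fillings,
and these are the ones with palindromic boundary. -/
theorem bijOn_tableauOfMatching (n : ℕ) :
    Set.BijOn tableauOfMatching {M : SetPartition n | IsMatching M ∧ IsBilaterallySymmetric M}
      {w | w ∈ pathSet YoungStep (fun _ => True) (2 * n) ⊥ ∧ IsPalindromic w} := by
  refine ⟨?_, ?_, ?_⟩
  · rintro M ⟨hM, hsym⟩
    have h := hM.isArcFilling.isOscSeq
    refine ⟨⟨?_, fun _ => trivial, fun i => ?_⟩, ?_⟩
    · refine youngDiagram_ext fun k => ?_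
      rw [hM.rowLen_tableau, rowLen_bot]
      exact h.start k
    · rw [YoungStep, addsSquare_iff, addsSquare_iff, funext (hM.rowLen_tableau _),
        funext (hM.rowLen_tableau _)]
      exact h.step i i.isLt
    · funext p
      refine youngDiagram_ext fun k => ?_
      rw [reversal, hM.rowLen_tableau, hM.rowLen_tableau,
        hM.isArcFilling.transposeFilling_eq_iff.1 (hM.isBilaterallySymmetric_iff.1 hsym) p
          (by omega), Fin.val_rev]
      congr 1
      omega
  · rintro M ⟨hM, -⟩ M' ⟨hM', -⟩ h
    refine hM.eq_of_arcFilling_eq hM' (hM.isArcFilling.eq_of_growthSeq_eq hM'.isArcFilling ?_)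
    intro p hp k
    have := congrArg (fun μ => YoungDiagram.rowLen μ k) (congrFun h ⟨p, by omega⟩)
    rwa [hM.rowLen_tableau, hM'.rowLen_tableau] at this
  · rintro w ⟨⟨h0, -, hstep⟩, hpal⟩
    set T : ℕ → ℕ → ℕ := fun p k => if h : p < 2 * n + 1 then (w ⟨p, h⟩).rowLen k else 0 with hT
    have hTw : ∀ p : Fin (2 * n + 1), ∀ k, T p k = (w p).rowLen k := fun p k => by
      simp only [hT]; rw [dif_pos p.isLt]
    have hosc : IsOscSeq (2 * n) T := by
      refine ⟨fun k => ?_, fun k => ?_, fun p hp => ?_, fun p hp => ?_⟩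
      · have := hTw 0 k
        rwa [h0, rowLen_bot] at this
      · have := hTw (Fin.last _) k
        rwa [palindromic_last hpal, h0, rowLen_bot] at this
      · rw [funext (hTw ⟨p, by omega⟩)]
        exact fun a b hab => YoungDiagram.rowLen_anti _ a b hab
      · have := hstep ⟨p, hp⟩
        rw [YoungStep, addsSquare_iff, addsSquare_iff] at this
        rwa [funext (hTw ⟨p, by omega⟩), funext (hTw ⟨p + 1, by omega⟩)]
    obtain ⟨x, hx, hxT⟩ := hosc.exists_filling
    obtain ⟨M, hM, rfl⟩ := hx.exists_matching
    refine ⟨M, ⟨hM, ?_⟩, ?_⟩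
    · rw [hM.isBilaterallySymmetric_iff, hx.transposeFilling_eq_iff]
      intro p hp k
      rw [hxT p hp, hxT _ (Nat.sub_le _ _)]
      have h1 := hTw ⟨p, by omega⟩ k
      have h2 := hTw ⟨2 * n - p, by omega⟩ k
      rw [hpal, reversal] at h1
      simp only at h1 h2
      rw [h1, h2]
      congr 2
      ext
      rw [Fin.val_rev]
      simp only
      omega
    · funext p
      refine youngDiagram_ext fun k => ?_
      rw [hM.rowLen_tableau, hxT p (by omega), hTw]

theorem bijOn_sep {α β : Type*} {f : α → β} {s : Set α} {t : Set β} (h : Set.BijOn f s t)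
    {p : α → Prop} {q : β → Prop} (hpq : ∀ x ∈ s, (p x ↔ q (f x))) :
    Set.BijOn f {x | x ∈ s ∧ p x} {y | y ∈ t ∧ q y} := by
  refine ⟨fun x hx => ⟨h.mapsTo hx.1, (hpq x hx.1).1 hx.2⟩, h.injOn.mono fun x hx => hx.1, ?_⟩
  rintro y ⟨hy, hqy⟩
  obtain ⟨x, hx, rfl⟩ := h.surjOn hy
  exact ⟨x, ⟨hx, (hpq x hx).2 hqy⟩, rfl⟩

theorem encard_symmetricNoncrossing (d n : ℕ) :
    (symmetricNoncrossing d n).encard = (palindromicTableaux d n).encard := by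
  have h := bijOn_sep (bijOn_tableauOfMatching n) (p := fun M => ¬ HasCrossing (d + 1) M)
    (q := fun w => ∀ i, (w i).colLen 0 ≤ d) (fun M hM => by
      rw [hasCrossing_iff]
      push Not
      have hM := hM.1
      constructor
      · intro h p
        rw [← rowLen_eq_zero_iff, hM.rowLen_tableau]
        by_contra hne
        exact h p (by omega) ((hM.isArcFilling.isPartialPerm.growthRow_ne_zero_iff d _ _).1 hne)
      · intro h p hp hanti
        have := h ⟨p, by omega⟩
        rw [← rowLen_eq_zero_iff, hM.rowLen_tableau] at this
        exact (hM.isArcFilling.isPartialPerm.growthRow_ne_zero_iff d _ _).2 hanti this)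
  rw [palindromicTableaux_eq]
  refine (congrArg Set.encard ?_).trans ((Set.encard_congr h.equiv).trans (congrArg Set.encard ?_))
  · ext M
    exact and_assoc.symm
  · ext w
    exact ⟨fun ⟨⟨⟨h1, _, h2⟩, h3⟩, h4⟩ => ⟨⟨h1, h4, h2⟩, h3⟩,
      fun ⟨⟨h1, h4, h2⟩, h3⟩ => ⟨⟨⟨h1, fun _ => trivial, h2⟩, h3⟩, h4⟩⟩

/-- Nestings bound the first row instead of the first column. Folding to paths of length `n`,
transposing every diagram and unfolding again exchanges the two bounds. -/
theorem encard_symmetricNonnesting (d n : ℕ) :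
    (symmetricNonnesting d n).encard = (palindromicTableaux d n).encard := by
  have h := bijOn_sep (bijOn_tableauOfMatching n) (p := fun M => ¬ HasNesting (d + 1) M)
    (q := fun w => ∀ i, (w i).rowLen 0 ≤ d) (fun M hM => by
      rw [hasNesting_iff]
      push Not
      have hM := hM.1
      constructor
      · intro h p
        rw [hM.rowLen_tableau]
        by_contra hne
        exact h p (by omega) ((hM.isArcFilling.isPartialPerm.le_chainLen_iff _ _ _).1
          (Nat.succ_le_of_lt (not_le.1 hne)))
      · intro h p hp hchain
        have h1 := h ⟨p, by omega⟩
        rw [hM.rowLen_tableau] at h1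
        have h2 := (hM.isArcFilling.isPartialPerm.le_chainLen_iff _ _ _).2 hchain
        exact absurd (h2.trans h1) (by omega))
  rw [encard_palindromicTableaux, boundedTableaux_eq]
  have hbij : Set.BijOn YoungDiagram.transpose {μ | μ.colLen 0 ≤ d} {μ | μ.rowLen 0 ≤ d} := by
    refine ⟨fun μ h => ?_, fun μ _ ν _ h => YoungDiagram.transpose_eq_iff.1 h, fun μ h =>
      ⟨μ.transpose, ?_, μ.transpose_transpose⟩⟩
    · rwa [Set.mem_ofPred_eq, YoungDiagram.rowLen_transpose]
    · rwa [Set.mem_ofPred_eq, YoungDiagram.colLen_transpose]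
  have hadd : ∀ μ ν : YoungDiagram, AddsSquare μ ν ↔ AddsSquare μ.transpose ν.transpose :=
    fun μ ν => ⟨addsSquare_transpose, fun h => by
      simpa only [YoungDiagram.transpose_transpose] using addsSquare_transpose h⟩
  have hbot : (⊥ : YoungDiagram).transpose = ⊥ := by
    refine youngDiagram_ext fun k => ?_
    rw [rowLen_bot, YoungDiagram.rowLen_transpose]
    by_contra hk
    exact YoungDiagram.notMem_bot _ (YoungDiagram.mem_iff_lt_colLen.2 (Nat.pos_of_ne_zero hk))
  rw [encard_pathSet_congr (R' := YoungStep) hbij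
    (fun μ ν _ _ => by rw [YoungStep, YoungStep, ← hadd, ← hadd]) n
    (by rw [← rowLen_eq_zero_iff, rowLen_bot]), hbot,
    ← encard_palindromic_pathSet fun _ _ => YoungStep.symm]
  refine (congrArg Set.encard ?_).trans ((Set.encard_congr h.equiv).trans (congrArg Set.encard ?_))
  · ext M
    exact and_assoc.symm
  · ext w
    exact ⟨fun ⟨⟨⟨h1, _, h2⟩, h3⟩, h4⟩ => ⟨⟨h1, h4, h2⟩, h3⟩,
      fun ⟨⟨h1, h4, h2⟩, h3⟩ => ⟨⟨⟨h1, fun _ => trivial, h2⟩, h3⟩, h4⟩⟩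

end Matching

/-! ### Vandermonde products and a Lagrange interpolation identity -/

section PairProd

variable {σ R : Type*} [LinearOrder σ] [CommMonoid R]

/-- The product of `f i j` over all `i < j` in `S`. -/
def pairProd (S : Finset σ) (f : σ → σ → R) : R :=
  ∏ i ∈ S, ∏ j ∈ S, if i < j then f i j else 1

theorem pairProd_erase {S : Finset σ} {i : σ} (hi : i ∈ S) (f : σ → σ → R) :
    pairProd S f =
      pairProd (S.erase i) f * ∏ k ∈ S.erase i, if k < i then f k i else f i k := by
  have hne : i ∉ S.erase i := notMem_erase i S
  rw [pairProd, ← insert_erase hi, prod_insert hne, prod_insert hne, if_neg (lt_irrefl i), one_mul]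
  simp only [prod_insert hne]
  rw [prod_mul_distrib, ← mul_assoc, ← prod_mul_distrib, mul_comm, erase_insert hne, pairProd]
  congr 1
  refine prod_congr rfl fun k hk => ?_
  rcases lt_or_gt_of_ne (ne_of_mem_erase hk) with h | h
  · rw [if_neg h.asymm, if_pos h, if_pos h, one_mul]
  · rw [if_pos h, if_neg h.asymm, if_neg h.asymm, mul_one]

theorem pairProd_congr {S : Finset σ} {f g : σ → σ → R} (h : ∀ i ∈ S, ∀ j ∈ S, f i j = g i j) :
    pairProd S f = pairProd S g :=
  prod_congr rfl fun i hi => prod_congr rfl fun j hj => by rw [h i hi j hj]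

theorem map_pairProd {R' F : Type*} [CommMonoid R'] [FunLike F R R'] [MonoidHomClass F R R']
    (φ : F) (S : Finset σ) (f : σ → σ → R) :
    φ (pairProd S f) = pairProd S fun i j => φ (f i j) := by
  simp only [pairProd, map_prod]
  refine prod_congr rfl fun i _ => prod_congr rfl fun j _ => ?_
  split_ifs <;> simp

end PairProd

section Lagrange

/-- Interpolate $\prod_{y\in S}(1-yX)$, of degree at most $|S|$, at the $|S|+2$ nodes
$S\cup\{0,-1\}$: its coefficient of degree $|S|+1$ is zero. The nodes 0 and −1 contribute the
right-hand side; at a node $x$ the factor $1-x^2$ cancels the distance $1+x$ to the node −1. -/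
theorem sum_prod_lagrange {K : Type*} [Field K] [DecidableEq K] (S : Finset K) (h0 : (0 : K) ∉ S)
    (h1 : (-1 : K) ∉ S) :
    ∑ x ∈ S, (1 - x) * ∏ y ∈ S.erase x, y * (1 - x * y) / (y - x) = 1 - ∏ y ∈ S, y := by
  set P : Polynomial K := ∏ y ∈ S, (1 - Polynomial.C y * Polynomial.X) with hP
  have hdeg : P.natDegree ≤ S.card := by
    refine (Polynomial.natDegree_prod_le _ _).trans ?_
    rw [card_eq_sum_ones]
    refine sum_le_sum fun y _ => ?_
    compute_degree
  have hm1 : (0 : K) ≠ -1 := by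
    intro h
    have : (1 : K) = 0 := by linear_combination h
    exact one_ne_zero this
  have h0' : (0 : K) ∉ insert (-1) S := by
    rw [mem_insert, not_or]; exact ⟨hm1, h0⟩
  have hcard : (insert 0 (insert (-1) S)).card = S.card + 2 := by
    rw [card_insert_of_notMem h0', card_insert_of_notMem h1]
  have heval : ∀ x, P.eval x = ∏ y ∈ S, (1 - x * y) := by
    intro x
    rw [hP, Polynomial.eval_prod]
    refine prod_congr rfl fun y _ => ?_
    rw [Polynomial.eval_sub, Polynomial.eval_one, Polynomial.eval_mul, Polynomial.eval_C,
      Polynomial.eval_X, mul_comm]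
  have key := Lagrange.coeff_eq_sum (s := insert 0 (insert (-1) S)) (v := (id : K → K))
    (Function.injective_id.injOn) (P := P) (by
      rw [hcard]
      refine Polynomial.degree_le_natDegree.trans_lt ?_
      exact_mod_cast (by omega : P.natDegree < S.card + 2))
  rw [hcard, Polynomial.coeff_eq_zero_of_natDegree_lt (by omega), sum_insert h0', sum_insert h1]
    at key
  simp only [id, heval] at key
  have hW : ∏ y ∈ S, (-y) ≠ 0 := prod_ne_zero_iff.2 fun y hy =>
    neg_ne_zero.2 (ne_of_mem_of_not_mem hy h0)
  have hV : ∏ y ∈ S, (1 + y) ≠ 0 := prod_ne_zero_iff.2 fun y hy h =>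
    h1 (by rwa [show (-1 : K) = y by linear_combination -h])
  have hneg : ∀ f : K → K, ∏ y ∈ S, (-f y) = (-1) ^ S.card * ∏ y ∈ S, f y := fun f => by
    rw [prod_neg]
  have t0 : (∏ y ∈ S, (1 - 0 * y)) / ∏ y ∈ (insert 0 (insert (-1) S)).erase 0, (0 - y) =
      1 / ∏ y ∈ S, (-y) := by
    rw [erase_insert h0', prod_insert h1]
    simp
  have t1 : (∏ y ∈ S, (1 - -1 * y)) / ∏ y ∈ (insert 0 (insert (-1) S)).erase (-1), (-1 - y) =
      - (∏ y ∈ S, y) / ∏ y ∈ S, (-y) := by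
    rw [Finset.insert_comm, erase_insert (by rw [mem_insert, not_or]; exact ⟨hm1.symm, h1⟩),
      prod_insert h0]
    simp only [neg_one_mul, sub_neg_eq_add, sub_zero]
    have e : ∏ y ∈ S, (-1 - y) = (-1) ^ S.card * ∏ y ∈ S, (1 + y) := by
      rw [← hneg]; exact prod_congr rfl fun y _ => by ring
    rw [e, hneg fun y => y]
    have hZ : ∏ y ∈ S, y ≠ 0 := prod_ne_zero_iff.2 fun y hy => ne_of_mem_of_not_mem hy h0
    have hs : ((-1 : K)) ^ S.card ≠ 0 := pow_ne_zero _ (by simp)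
    have hs2 : ((-1 : K)) ^ S.card * (-1) ^ S.card = 1 := by
      rw [← mul_pow]; simp
    field_simp
    
  have t2 : ∀ x ∈ S, (∏ y ∈ S, (1 - x * y)) / ∏ y ∈ (insert 0 (insert (-1) S)).erase x, (x - y) =
      - ((1 - x) * ∏ y ∈ S.erase x, y * (1 - x * y) / (y - x)) / ∏ y ∈ S, (-y) := by
    intro x hx
    have hx0 : x ≠ 0 := ne_of_mem_of_not_mem hx h0
    have hx1 : x ≠ -1 := ne_of_mem_of_not_mem hx h1
    have hx1' : 1 + x ≠ 0 := fun h => hx1 (by linear_combination h)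
    rw [erase_insert_of_ne hx0.symm, erase_insert_of_ne hx1.symm, prod_insert, prod_insert]
    · rw [← mul_prod_erase S _ hx, ← mul_prod_erase S (fun y => -y) hx]
      have hU : ∏ y ∈ S.erase x, (-y) ≠ 0 := prod_ne_zero_iff.2 fun y hy =>
        neg_ne_zero.2 (ne_of_mem_of_not_mem (mem_of_mem_erase hy) h0)
      have hD : ∏ y ∈ S.erase x, (x - y) ≠ 0 := prod_ne_zero_iff.2 fun y hy =>
        sub_ne_zero.2 (ne_of_mem_erase hy).symm
      have e : ∏ y ∈ S.erase x, y * (1 - x * y) / (y - x) =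
          (∏ y ∈ S.erase x, (-y)) * (∏ y ∈ S.erase x, (1 - x * y)) /
            ∏ y ∈ S.erase x, (x - y) := by
        rw [← prod_mul_distrib, ← prod_div_distrib]
        refine prod_congr rfl fun y hy => ?_
        rw [neg_mul, ← neg_sub y x, neg_div_neg_eq]
      rw [e, show (1 - x * x) = (1 - x) * (1 + x) by ring, sub_neg_eq_add, add_comm x 1]
      field_simp
      ring
    · exact fun h => h1 (mem_of_mem_erase h)
    · rw [mem_insert, not_or]
      exact ⟨hm1, fun h => h0 (mem_of_mem_erase h)⟩
  rw [t0, t1, sum_congr rfl t2, ← sum_div, ← add_div, ← add_div, eq_comm, div_eq_zero_iff,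
    or_iff_left hW, sum_neg_distrib] at key
  linear_combination -key

variable {σ : Type*} [LinearOrder σ]

/-- The sign by which removing `i` from `S` changes a Vandermonde product. -/
def eraseSign (R : Type*) [CommRing R] (S : Finset σ) (i : σ) : R :=
  ∏ k ∈ S.erase i, if k < i then -1 else 1

theorem map_eraseSign {R R' : Type*} [CommRing R] [CommRing R'] (φ : R →+* R') (S : Finset σ)
    (i : σ) : φ (eraseSign R S i) = eraseSign R' S i := by
  rw [eraseSign, eraseSign, map_prod]
  refine prod_congr rfl fun k _ => ?_
  split_ifs <;> simp

/-- This is `sum_prod_lagrange` with denominators cleared by the Vandermonde product: dropping `i`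
removes the factors `z k - z i` up to the sign `eraseSign`. -/
theorem sum_vandermonde_erase_field {K : Type*} [Field K] {z : σ → K} (hz : Function.Injective z)
    (h0 : ∀ i, z i ≠ 0) (h1 : ∀ i, z i ≠ -1) (S : Finset σ) :
    ∑ i ∈ S, eraseSign K S i * (1 - z i) * (∏ k ∈ S.erase i, z k * (1 - z i * z k)) *
      pairProd (S.erase i) (fun i j => z j - z i) =
    (1 - ∏ i ∈ S, z i) * pairProd S fun i j => z j - z i := by
  classical
  have key := sum_prod_lagrange (S.image z) (by simp [h0]) (by simp [h1])
  rw [sum_image hz.injOn, prod_image hz.injOn] at key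
  rw [← key, sum_mul]
  refine sum_congr rfl fun i hi => ?_
  rw [← image_erase hz, prod_image hz.injOn, pairProd_erase hi, prod_div_distrib]
  have e : (∏ k ∈ S.erase i, if k < i then z i - z k else z k - z i) =
      eraseSign K S i * ∏ k ∈ S.erase i, (z k - z i) := by
    rw [eraseSign, ← prod_mul_distrib]
    refine prod_congr rfl fun k _ => ?_
    split_ifs <;> ring
  have hD : ∏ k ∈ S.erase i, (z k - z i) ≠ 0 := prod_ne_zero_iff.2 fun k hk =>
    sub_ne_zero.2 (hz.ne (ne_of_mem_erase hk))
  rw [e]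
  field_simp

theorem sum_vandermonde_erase {R : Type*} [CommRing R] [IsDomain R] {z : σ → R}
    (hz : Function.Injective z) (h0 : ∀ i, z i ≠ 0) (h1 : ∀ i, z i ≠ -1) (S : Finset σ) :
    ∑ i ∈ S, eraseSign R S i * (1 - z i) * (∏ k ∈ S.erase i, z k * (1 - z i * z k)) *
      pairProd (S.erase i) (fun i j => z j - z i) =
    (1 - ∏ i ∈ S, z i) * pairProd S fun i j => z j - z i := by
  have hinj : Function.Injective (algebraMap R (FractionRing R)) :=
    IsFractionRing.injective R (FractionRing R)
  apply hinj
  simp only [map_sum, map_mul, map_prod, map_pairProd, map_sub, map_one, map_eraseSign]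
  refine sum_vandermonde_erase_field (hinj.comp hz) (fun i => ?_) (fun i => ?_) S
  · rw [Function.comp_apply, ← map_zero (algebraMap R (FractionRing R))]
    exact hinj.ne (h0 i)
  · rw [Function.comp_apply, ← map_one (algebraMap R (FractionRing R)), ← map_neg]
    exact hinj.ne (h1 i)

end Lagrange

/-! ### Littlewood's identity -/

section Littlewood

open MvPowerSeries

variable {σ : Type*} [LinearOrder σ]

/-- The sign of `b - a`. -/
def cmpSign (a b : ℕ) : ℚ := if a < b then 1 else if b < a then -1 else 0

/-- The generating function of the strict order of the exponents of the variables in `S`. -/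
noncomputable def orderSeries (S : Finset σ) : MvPowerSeries σ ℚ := fun m =>
  open Classical in
  if ∀ i ∉ S, m i = 0 then pairProd S fun i j => cmpSign (m i) (m j) else 0

theorem coeff_orderSeries_of_forall {S : Finset σ} {m : σ →₀ ℕ} (h : ∀ i ∉ S, m i = 0) :
    coeff m (orderSeries S) = pairProd S fun i j => cmpSign (m i) (m j) := if_pos h

theorem coeff_orderSeries_of_ne {S : Finset σ} {m : σ →₀ ℕ} {i : σ} (hi : i ∉ S) (h : m i ≠ 0) :
    coeff m (orderSeries S) = 0 := if_neg fun h' => h (h' i hi)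

theorem prod_X_eq_monomial (S : Finset σ) :
    ∏ k ∈ S, (X k : MvPowerSeries σ ℚ) = monomial (∑ k ∈ S, Finsupp.single k 1) 1 := by
  induction S using Finset.induction_on with
  | empty => simp
  | insert i S hi ih =>
    rw [prod_insert hi, sum_insert hi, ih, X, monomial_mul_monomial, one_mul]

theorem sum_single_apply (S : Finset σ) (i : σ) :
    (∑ k ∈ S, Finsupp.single k 1 : σ →₀ ℕ) i = if i ∈ S then 1 else 0 := by
  rw [Finsupp.finsetSum_apply]
  simp [Finsupp.single_apply]

theorem sum_single_le_iff (S : Finset σ) (m : σ →₀ ℕ) :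
    (∑ k ∈ S, Finsupp.single k 1 : σ →₀ ℕ) ≤ m ↔ ∀ i ∈ S, m i ≠ 0 := by
  rw [Finsupp.le_def]
  refine forall_congr' fun i => ?_
  rw [sum_single_apply]
  split_ifs with h
  · simp [h]; omega
  · simp [h]

theorem coeff_prod_X_mul (S : Finset σ) (m : σ →₀ ℕ) (F : MvPowerSeries σ ℚ) :
    coeff m ((∏ k ∈ S, X k) * F) = open Classical in
      if ∀ i ∈ S, m i ≠ 0 then coeff (m - ∑ k ∈ S, Finsupp.single k 1) F else 0 := by
  rw [prod_X_eq_monomial, coeff_monomial_mul, one_mul]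
  simp only [sum_single_le_iff]

theorem cmpSign_sub_one {a b : ℕ} (ha : a ≠ 0) (hb : b ≠ 0) :
    cmpSign (a - 1) (b - 1) = cmpSign a b := by
  rw [cmpSign, cmpSign]
  congr 1
  · rw [eq_iff_iff]; omega
  · congr 1
    rw [eq_iff_iff]; omega

theorem pairProd_cmpSign_sub (S : Finset σ) {m : σ →₀ ℕ} (h : ∀ i ∈ S, m i ≠ 0) :
    (pairProd S fun i j => cmpSign ((m - ∑ k ∈ S, Finsupp.single k 1 : σ →₀ ℕ) i)
      ((m - ∑ k ∈ S, Finsupp.single k 1 : σ →₀ ℕ) j)) = pairProd S fun i j => cmpSign (m i) (m j) := by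
  refine pairProd_congr fun i hi j hj => ?_
  rw [Finsupp.tsub_apply, Finsupp.tsub_apply, sum_single_apply, sum_single_apply, if_pos hi,
    if_pos hj, cmpSign_sub_one (h i hi) (h j hj)]

/-- The order sign does not change when all exponents are shifted by one, so the factor leaves only
exponents with a zero entry. Two zeros give sign 0; a single zero at `i` is the minimum, and
comparing it with the others yields `eraseSign`. -/
theorem one_sub_prod_mul_orderSeries (S : Finset σ) :
    (1 - ∏ k ∈ S, X k) * orderSeries S =
      ∑ i ∈ S, eraseSign (MvPowerSeries σ ℚ) S i * ((∏ k ∈ S.erase i, X k) *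
        orderSeries (S.erase i)) := by
  have hsign : ∀ i, eraseSign (MvPowerSeries σ ℚ) S i = C (eraseSign ℚ S i) := fun i =>
    (map_eraseSign _ _ _).symm
  ext m
  rw [sub_mul, one_mul, map_sub, map_sum, coeff_prod_X_mul]
  simp only [hsign, coeff_C_mul, coeff_prod_X_mul]
  by_cases hout : ∃ k ∉ S, m k ≠ 0
  · obtain ⟨k, hk, hmk⟩ := hout
    have hzero : ∀ T ⊆ S, coeff (m - ∑ k ∈ T, Finsupp.single k 1) (orderSeries T) = 0 := by
      intro T hT
      have hkT : k ∉ T := fun h => hk (hT h)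
      refine coeff_orderSeries_of_ne hkT ?_
      rw [Finsupp.tsub_apply, sum_single_apply, if_neg hkT]
      omega
    rw [coeff_orderSeries_of_ne hk hmk, hzero S subset_rfl, ite_self, sub_zero]
    refine (sum_eq_zero fun i _ => ?_).symm
    rw [hzero _ (erase_subset _ _), ite_self, mul_zero]
  push Not at hout
  rw [coeff_orderSeries_of_forall hout]
  by_cases hall : ∀ i ∈ S, m i ≠ 0
  · rw [if_pos hall, coeff_orderSeries_of_forall, pairProd_cmpSign_sub S hall, sub_self]
    · refine (sum_eq_zero fun i hi => ?_).symm
      rw [coeff_orderSeries_of_ne (i := i) (notMem_erase _ _), ite_self, mul_zero]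
      rw [Finsupp.tsub_apply, sum_single_apply, if_neg (notMem_erase _ _)]
      exact hall i hi
    · intro i hi
      rw [Finsupp.tsub_apply, hout i hi, zero_tsub]
  · rw [if_neg hall, sub_zero]
    push Not at hall
    obtain ⟨i, hi, hmi⟩ := hall
    rw [sum_eq_single i, pairProd_erase hi]
    · split_ifs with h
      · rw [coeff_orderSeries_of_forall, pairProd_cmpSign_sub _ h, mul_comm]
        · congr 1
          refine prod_congr rfl fun k hk => ?_
          have := h k hk
          rw [hmi, cmpSign, cmpSign]
          split_ifs <;> first | rfl | omega
        · intro k hk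
          rw [Finsupp.tsub_apply, sum_single_apply, if_neg hk, tsub_zero]
          by_cases hki : k = i
          · rw [hki, hmi]
          · exact hout k fun h => hk (mem_erase.2 ⟨hki, h⟩)
      · push Not at h
        obtain ⟨k, hk, hmk⟩ := h
        rw [mul_zero, prod_eq_zero hk, mul_zero]
        rw [hmi, hmk, ite_self, cmpSign]
        simp
    · intro k hk hki
      rw [if_neg, mul_zero]
      intro h
      exact h i (mem_erase.2 ⟨hki.symm, hi⟩) hmi
    · exact fun h => absurd hi h

/-- Littlewood's identity for the sum of all Schur functions. -/
theorem prod_mul_orderSeries (S : Finset σ) :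
    (∏ i ∈ S, (1 - X i)) * (pairProd S fun i j => 1 - X i * X j) * orderSeries S =
      pairProd S fun i j => (X j - X i : MvPowerSeries σ ℚ) := by
  have : IsDomain (MvPowerSeries σ ℚ) := NoZeroDivisors.to_isDomain _
  induction S using Finset.strongInduction with
  | H S ih =>
  rcases S.eq_empty_or_nonempty with rfl | ⟨i₀, hi₀⟩
  · simp only [pairProd, prod_empty, one_mul]
    ext m
    rw [coeff_one]
    by_cases hm : m = 0
    · rw [if_pos hm, coeff_orderSeries_of_forall (by simp [hm])]
      simp [pairProd]
    · rw [if_neg hm]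
      obtain ⟨i, hi⟩ := DFunLike.ne_iff.1 hm
      exact coeff_orderSeries_of_ne (notMem_empty i) hi
  · have hX : ∀ i : σ, (X i : MvPowerSeries σ ℚ) ≠ 0 := fun i h => by
      have := congrArg (coeff (Finsupp.single i 1)) h
      simp at this
    have hcc : ∀ i : σ, constantCoeff (X i : MvPowerSeries σ ℚ) = 0 := constantCoeff_X
    have hne : (1 - ∏ k ∈ S, X k : MvPowerSeries σ ℚ) ≠ 0 := by
      intro h
      have := congrArg constantCoeff h
      rw [map_sub, map_prod, prod_eq_zero hi₀ (hcc i₀)] at this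
      simp at this
    -- After multiplication by `1 - ∏ X k` both sides are sums over the removed index, matched term
    -- by term by the induction hypothesis for `S.erase i`.
    apply mul_left_cancel₀ hne
    rw [← sum_vandermonde_erase (fun i j h => X_inj.1 h) hX
      (fun i h => by have := congrArg constantCoeff h; simp at this),
      show ∀ a b c d : MvPowerSeries σ ℚ, a * (b * c * d) = b * c * (a * d) by intros; ring,
      one_sub_prod_mul_orderSeries, mul_sum]
    refine sum_congr rfl fun i hi => ?_
    rw [← ih _ (erase_ssubset hi), pairProd_erase hi, ← mul_prod_erase S _ hi, prod_mul_distrib]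
    have e : (∏ k ∈ S.erase i, if k < i then 1 - X k * X i else 1 - X i * X k) =
        ∏ k ∈ S.erase i, (1 - X i * X k : MvPowerSeries σ ℚ) :=
      prod_congr rfl fun k _ => by rw [mul_comm (X k), ite_self]
    rw [e]
    ring

end Littlewood

/-! ### The recursion for walks in the chamber -/

section WalkCount

/-- The first step decomposition of the number of paths. -/
theorem encard_pathSet_succ {α ι : Type*} [Fintype ι] {R : α → α → Prop} {P : α → Prop} {a : α}
    (ha : P a) {g : ι → α} (hg : Function.Injective g) (hR : ∀ y, R a y ↔ ∃ i, y = g i) (m : ℕ) :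
    (pathSet R P (m + 1) a).encard = ∑ i, (pathSet R P m (g i)).encard := by
  have hinj : Function.Injective fun w : Fin (m + 1) → α => (Fin.cons a w : Fin (m + 2) → α) :=
    Fin.cons_right_injective (α := fun _ => α) a
  have hU : pathSet R P (m + 1) a =
      ⋃ i, (fun w => (Fin.cons a w : Fin (m + 2) → α)) '' pathSet R P m (g i) := by
    ext w
    simp only [Set.mem_iUnion, Set.mem_image]
    constructor
    · rintro ⟨h0, hP, hstep⟩
      obtain ⟨i, hi⟩ := (hR (w 1)).1 (by rw [← h0]; exact hstep 0)
      refine ⟨i, Fin.tail w, ⟨hi, fun j => hP j.succ, fun j => hstep j.succ⟩, ?_⟩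
      rw [← h0]
      exact Fin.cons_self_tail w
    · rintro ⟨i, w, ⟨h0, hP, hstep⟩, rfl⟩
      refine ⟨Fin.cons_zero _ _, Fin.cases ha hP, Fin.cases ?_ fun j => ?_⟩
      · rw [Fin.castSucc_zero, Fin.cons_zero, Fin.cons_succ, h0, hR]
        exact ⟨i, rfl⟩
      · rw [Fin.cons_succ, ← Fin.succ_castSucc, Fin.cons_succ]
        exact hstep j
  rw [hU, Set.encard_iUnion_of_finite, finsum_eq_sum_of_fintype]
  · exact sum_congr rfl fun i _ => hinj.encard_image _
  · intro i j hij
    refine Set.disjoint_left.2 ?_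
    rintro _ ⟨w, hw, rfl⟩ ⟨w', hw', h⟩
    have := hinj h
    subst this
    exact hij (hg (hw.1.symm.trans hw'.1))

theorem pathSet_eq_empty {α : Type*} {R : α → α → Prop} {P : α → Prop} {a : α} (ha : ¬ P a)
    (m : ℕ) : pathSet R P m a = ∅ := by
  refine Set.eq_empty_of_forall_notMem fun w hw => ha ?_
  rw [← hw.1]
  exact hw.2.1 0

theorem encard_pathSet_zero {α : Type*} {R : α → α → Prop} {P : α → Prop} {a : α} (ha : P a) :
    (pathSet R P 0 a).encard = 1 := by
  rw [Set.encard_eq_one]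
  refine ⟨fun _ => a, Set.eq_singleton_iff_unique_mem.2 ⟨⟨rfl, fun _ => ha, fun i => i.elim0⟩,
    fun w hw => funext fun i => ?_⟩⟩
  rw [show i = 0 from Subsingleton.elim (α := Fin 1) i 0, hw.1]

/-- The neighbours of a lattice point. -/
def latticeNeighbor {d : ℕ} (x : Fin d → ℤ) (s : Fin d × Bool) : Fin d → ℤ :=
  if s.2 then x + Pi.single s.1 1 else x - Pi.single s.1 1

theorem latticeNeighbor_injective {d : ℕ} (x : Fin d → ℤ) :
    Function.Injective (latticeNeighbor x) := by
  rintro ⟨i, b⟩ ⟨j, c⟩ h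
  have hi := congrFun h i
  have hj := congrFun h j
  by_cases hij : i = j
  · subst hij
    cases b <;> cases c <;> simp [latticeNeighbor] at hi ⊢ <;> omega
  · cases b <;> cases c <;>
      simp [latticeNeighbor, hij] at hi

/-- A solution of the recursion of the walk numbers which vanishes on the walls counts walks in the
Weyl chamber. -/
theorem encard_pathSet_eq_of_recursion {d : ℕ} {f : ℕ → (Fin d → ℤ) → ℚ}
    (h0 : ∀ x ∈ weylChamber d, f 0 x = 1)
    (hsucc : ∀ n x, f (n + 1) x = ∑ k, (f n (x + Pi.single k 1) + f n (x - Pi.single k 1)))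
    (hwall : ∀ n x i j, i ≠ j → x i = x j → f n x = 0)
    (hzero : ∀ n x i, x i = 0 → f n x = 0) (n : ℕ) {x : Fin d → ℤ} (hx : x ∈ weylChamber d) :
    ∃ N : ℕ, (N : ℚ) = f n x ∧ (pathSet LatticeStep (· ∈ weylChamber d) n x).encard = N := by
  -- A step moves one coordinate by one, so a walk cannot leave the chamber without landing on a
  -- wall, where `f` vanishes.
  have hbdry : ∀ x ∈ weylChamber d, ∀ s, latticeNeighbor x s ∉ weylChamber d →
      (∃ i j, i ≠ j ∧ latticeNeighbor x s i = latticeNeighbor x s j) ∨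
        ∃ i, latticeNeighbor x s i = 0 := by
    intro x hx s hs
    by_contra! hcon
    apply hs
    have hval : ∀ i, latticeNeighbor x s i = x i ∨
        (i = s.1 ∧ (latticeNeighbor x s i = x i + 1 ∨ latticeNeighbor x s i = x i - 1)) := by
      intro i
      by_cases hi : i = s.1
      · right
        refine ⟨hi, ?_⟩
        rw [latticeNeighbor]
        split_ifs
        · left; simp [hi]
        · right; simp [hi]
      · left
        rw [latticeNeighbor]
        split_ifs <;> simp [hi]
    refine ⟨fun i j hij => ?_, fun i => ?_⟩
    · have h1 := hx.1 hij
      have h2 := hcon.1 i j hij.ne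
      rcases hval i with hi | ⟨hi, hi'⟩ <;> rcases hval j with hj | ⟨hj, hj'⟩
      · omega
      · omega
      · omega
      · exact absurd (hi.trans hj.symm) hij.ne
    · have h1 := hx.2 i
      have h2 := hcon.2 i
      rcases hval i with hi | ⟨hi, hi'⟩ <;> omega
  induction n generalizing x with
  | zero => exact ⟨1, by rw [h0 x hx, Nat.cast_one], by rw [encard_pathSet_zero hx, Nat.cast_one]⟩
  | succ n ih =>
    have key : ∀ s, ∃ N : ℕ, (N : ℚ) = f n (latticeNeighbor x s) ∧
        (pathSet LatticeStep (· ∈ weylChamber d) n (latticeNeighbor x s)).encard = N := by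
      intro s
      by_cases hs : latticeNeighbor x s ∈ weylChamber d
      · exact ih hs
      · refine ⟨0, ?_, by rw [pathSet_eq_empty hs, Set.encard_empty, Nat.cast_zero]⟩
        rcases hbdry x hx s hs with ⟨i, j, hij, h⟩ | ⟨i, h⟩
        · rw [hwall n _ i j hij h, Nat.cast_zero]
        · rw [hzero n _ i h, Nat.cast_zero]
    choose N hN hN' using key
    refine ⟨∑ s, N s, ?_, ?_⟩
    · push_cast
      simp only [hN, hsucc]
      rw [Fintype.sum_prod_type]
      refine sum_congr rfl fun k _ => ?_
      simp [latticeNeighbor]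
    · rw [encard_pathSet_succ hx (latticeNeighbor_injective x), Nat.cast_sum]
      · simp only [hN']
      · intro y
        rw [LatticeStep, Prod.exists]
        refine exists_congr fun k => ?_
        simp [latticeNeighbor, or_comm]

end WalkCount

/-! ### Laurent polynomials and antisymmetric functionals -/

section Laurent

/-- Laurent polynomials in `d` variables. -/
abbrev Laurent (d : ℕ) : Type := AddMonoidAlgebra ℚ (Fin d → ℤ)

variable {d : ℕ}

/-- The Laurent monomial with exponent `y`. -/
noncomputable def laurentMono (y : Fin d → ℤ) : Laurent d := AddMonoidAlgebra.single y 1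

theorem laurentMono_mul (x y : Fin d → ℤ) :
    laurentMono x * laurentMono y = laurentMono (x + y) := by
  simp [laurentMono]

theorem laurentMono_zero : laurentMono (0 : Fin d → ℤ) = 1 := rfl

theorem prod_laurentMono {ι : Type*} (s : Finset ι) (y : ι → Fin d → ℤ) :
    ∏ i ∈ s, laurentMono (y i) = laurentMono (∑ i ∈ s, y i) := by
  classical
  induction s using Finset.induction_on with
  | empty => simp [laurentMono_zero]
  | insert i s hi ih => rw [prod_insert hi, sum_insert hi, ih, laurentMono_mul]

/-- The power `n` of the variable `i`. -/
noncomputable def laurentVar (i : Fin d) (n : ℤ) : Laurent d := laurentMono (Pi.single i n)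

theorem laurentVar_mul (i : Fin d) (m n : ℤ) :
    laurentVar i m * laurentVar i n = laurentVar i (m + n) := by
  rw [laurentVar, laurentVar, laurentMono_mul, laurentVar, Pi.single_add]

theorem laurentVar_zero (i : Fin d) : laurentVar i 0 = 1 := by
  rw [laurentVar, Pi.single_zero, laurentMono_zero]

theorem laurentVar_pow (i : Fin d) (m : ℤ) (n : ℕ) :
    laurentVar i m ^ n = laurentVar i (n * m) := by
  induction n with
  | zero => simp [laurentVar_zero]
  | succ n ih =>
    rw [pow_succ, ih, laurentVar_mul]
    congr 1
    push_cast
    ring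

theorem prod_laurentVar (c : Fin d → ℤ) : ∏ i, laurentVar i (c i) = laurentMono c := by
  simp only [laurentVar]
  rw [prod_laurentMono, univ_sum_single]

/-- The linear functional on Laurent polynomials with the given values on monomials. -/
noncomputable def laurentPairing (φ : (Fin d → ℤ) → ℚ) : Laurent d →ₗ[ℚ] ℚ where
  toFun g := Finsupp.linearCombination ℚ φ g.coeff
  map_add' g h := by simp
  map_smul' a g := by simp

@[simp] theorem laurentPairing_mono (φ : (Fin d → ℤ) → ℚ) (y : Fin d → ℤ) :
    laurentPairing φ (laurentMono y) = φ y := by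
  simp [laurentPairing, laurentMono]

theorem laurent_induction {P : Laurent d → Prop} (g : Laurent d) (hmono : ∀ y, P (laurentMono y))
    (hadd : ∀ g h, P g → P h → P (g + h)) (hsmul : ∀ (a : ℚ) g, P g → P (a • g)) : P g :=
  AddMonoidAlgebra.induction_on g (fun y => hmono y) hadd hsmul

/-- The coefficients of a Laurent polynomial. -/
theorem coeff_mono_mul (c : Fin d → ℤ) (g : Laurent d) (y : Fin d → ℤ) :
    (laurentMono c * g).coeff y = g.coeff (y - c) := by
  rw [laurentMono, AddMonoidAlgebra.coeff_single_mul_eq_mul_coeff (m₂ := y - c), one_mul]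
  intro z _
  constructor
  · rintro rfl; simp
  · rintro rfl; simp

/-- The action of permutations of the variables. -/
noncomputable def laurentPerm (σ : Equiv.Perm (Fin d)) : Laurent d →+* Laurent d :=
  AddMonoidAlgebra.mapDomainRingHom ℚ
    (LinearMap.funLeft ℤ ℤ (σ⁻¹ : Equiv.Perm (Fin d))).toAddMonoidHom

theorem laurentPerm_mono (σ : Equiv.Perm (Fin d)) (y : Fin d → ℤ) :
    laurentPerm σ (laurentMono y) = laurentMono (y ∘ (σ⁻¹ : Equiv.Perm (Fin d))) := by
  simp [laurentPerm, laurentMono]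
  rfl

theorem laurentPerm_var (σ : Equiv.Perm (Fin d)) (i : Fin d) (n : ℤ) :
    laurentPerm σ (laurentVar i n) = laurentVar (σ i) n := by
  rw [laurentVar, laurentPerm_mono, laurentVar]
  congr 1
  funext j
  simp [Pi.single_apply, Equiv.symm_apply_eq]

theorem laurentPerm_smul (σ : Equiv.Perm (Fin d)) (a : ℚ) (g : Laurent d) :
    laurentPerm σ (a • g) = a • laurentPerm σ g := by
  simp [laurentPerm]

/-- The generating function of the steps. -/
noncomputable def stepPoly (d : ℕ) : Laurent d := ∑ k, (laurentVar k 1 + laurentVar k (-1))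

theorem laurentPerm_stepPoly (σ : Equiv.Perm (Fin d)) : laurentPerm σ (stepPoly d) = stepPoly d := by
  simp only [stepPoly, map_sum, map_add, laurentPerm_var]
  exact Equiv.sum_comp σ fun k => laurentVar k 1 + laurentVar k (-1)

/-- An antisymmetric function of lattice points. -/
def IsAntisymm (φ : (Fin d → ℤ) → ℚ) : Prop :=
  ∀ (σ : Equiv.Perm (Fin d)) y, φ (y ∘ σ) = (Equiv.Perm.sign σ : ℤ) * φ y

theorem IsAntisymm.pairing_perm {φ : (Fin d → ℤ) → ℚ} (hφ : IsAntisymm φ)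
    (σ : Equiv.Perm (Fin d)) (g : Laurent d) :
    laurentPairing φ (laurentPerm σ g) = (Equiv.Perm.sign σ : ℤ) * laurentPairing φ g := by
  induction g using laurent_induction with
  | hmono y => rw [laurentPerm_mono, laurentPairing_mono, laurentPairing_mono, hφ,
      Equiv.Perm.sign_inv]
  | hadd g h h1 h2 => rw [map_add, map_add, map_add, h1, h2, mul_add]
  | hsmul a g h => rw [laurentPerm_smul, map_smul, map_smul, h, smul_eq_mul, smul_eq_mul]; ring

/-- The term of `σ` in the determinant is the diagonal term with its variables permuted. Its sign
cancels the one coming from `φ`, so all `d!` terms pair equally. -/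
theorem IsAntisymm.pairing_det {φ : (Fin d → ℤ) → ℚ} (hφ : IsAntisymm φ)
    {Q : Fin d → Fin d → Laurent d} (hQ : ∀ σ i j, laurentPerm σ (Q i j) = Q (σ i) j)
    {h : Laurent d} (hh : ∀ σ, laurentPerm σ h = h) :
    laurentPairing φ ((Matrix.of Q).det * h) =
      (d.factorial : ℚ) * laurentPairing φ ((∏ i, Q i i) * h) := by
  rw [Matrix.det_apply, sum_mul, map_sum]
  have key : ∀ σ : Equiv.Perm (Fin d),
      laurentPairing φ ((Equiv.Perm.sign σ • ∏ i, Matrix.of Q (σ i) i) * h) =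
        laurentPairing φ ((∏ i, Q i i) * h) := by
    intro σ
    have e : (∏ i, Matrix.of Q (σ i) i) * h = laurentPerm σ ((∏ i, Q i i) * h) := by
      rw [map_mul, map_prod, hh]
      simp only [hQ, Matrix.of_apply]
    have hs : ((Equiv.Perm.sign σ : ℤ) : ℚ) * (Equiv.Perm.sign σ : ℤ) = 1 := by
      rw [← Int.cast_mul, ← Units.val_mul, Int.units_mul_self]
      simp
    rw [smul_mul_assoc, e, Units.smul_def, map_zsmul, hφ.pairing_perm, zsmul_eq_mul, ← mul_assoc,
      hs, one_mul]
  rw [sum_congr rfl fun σ _ => key σ, sum_const, card_univ, Fintype.card_perm, Fintype.card_fin,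
    nsmul_eq_mul]

theorem pairProd_univ {R : Type*} [CommMonoid R] (f : Fin d → Fin d → R) :
    pairProd univ f = ∏ i, ∏ j ∈ Ioi i, f i j := by
  refine prod_congr rfl fun i _ => ?_
  rw [← prod_filter, filter_lt_eq_Ioi]

/-- The antisymmetric extension of the indicator function of the chamber `0 < x_1 < ⋯ < x_d` to the
positive orthant. -/
noncomputable def chamberSign (y : Fin d → ℤ) : ℚ :=
  open Classical in
  if ∀ i, 0 < y i then pairProd univ fun i j => cmpSign (y i).toNat (y j).toNat else 0

theorem cmpSign_neg (a b : ℕ) : cmpSign a b = - cmpSign b a := by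
  rw [cmpSign, cmpSign]
  split_ifs <;> first | omega | simp

theorem isAntisymm_chamberSign : IsAntisymm (chamberSign (d := d)) := by
  intro σ y
  have hiff : (∀ i, 0 < (y ∘ σ) i) ↔ ∀ i, 0 < y i :=
    ⟨fun h i => by simpa using h (σ⁻¹ i), fun h i => h _⟩
  rw [chamberSign, chamberSign]
  by_cases h : ∀ i, 0 < y i
  · rw [if_pos h, if_pos (hiff.2 h), pairProd_univ, pairProd_univ]
    exact Equiv.Perm.prod_Ioi_comp_eq_sign_mul_prod σ (f := fun i j =>
      cmpSign (y i).toNat (y j).toNat) fun i j => cmpSign_neg _ _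
  · rw [if_neg h, if_neg (mt hiff.1 h), mul_zero]

theorem chamberSign_eq_one {y : Fin d → ℤ} (hy : StrictMono y) (h0 : ∀ i, 0 < y i) :
    chamberSign y = 1 := by
  rw [chamberSign, if_pos h0, pairProd_univ]
  refine prod_eq_one fun i _ => prod_eq_one fun j hj => ?_
  have h1 := hy (mem_Ioi.1 hj)
  have h2 := h0 i
  rw [cmpSign, if_pos (by omega)]

theorem chamberSign_eq_zero {y : Fin d → ℤ} {i : Fin d} (h : y i < 0) : chamberSign y = 0 :=
  if_neg fun h' => (h' i).not_gt h

/-- Expansion of a product of binomials. -/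
theorem prod_laurentVar_add (a b : Fin d → ℚ) (x y : Fin d → ℤ) :
    ∏ i, (a i • laurentVar i (x i) + b i • laurentVar i (y i)) =
      ∑ t : Finset (Fin d), (∏ i, t.piecewise a b i) • laurentMono (t.piecewise x y) := by
  rw [prod_add, powerset_univ]
  refine sum_congr rfl fun t _ => ?_
  rw [← prod_laurentVar, ← Finset.prod_smul]
  have h := prod_piecewise univ t (fun i => a i • laurentVar i (x i))
    fun i => b i • laurentVar i (y i)
  rw [univ_inter] at h
  rw [← h]
  refine prod_congr rfl fun i _ => ?_
  by_cases hi : i ∈ t <;> simp [hi]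

end Laurent

/-! ### The reflection principle -/

section SignedWalkSum

variable {d : ℕ}

/-- The odd Laurent polynomial `z_i ^ a - z_i ^ (-a)`. -/
noncomputable def oddVar (i : Fin d) (a : ℤ) : Laurent d := laurentVar i a - laurentVar i (-a)

theorem laurentPerm_oddVar (σ : Equiv.Perm (Fin d)) (i : Fin d) (a : ℤ) :
    laurentPerm σ (oddVar i a) = oddVar (σ i) a := by
  rw [oddVar, map_sub, laurentPerm_var, laurentPerm_var, oddVar]

theorem oddVar_mul_step (i : Fin d) (a : ℤ) :
    oddVar i a * (laurentVar i 1 + laurentVar i (-1)) = oddVar i (a + 1) + oddVar i (a - 1) := by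
  simp only [oddVar, sub_mul, mul_add, laurentVar_mul]
  rw [show -(a + 1) = -a + -1 by ring, show -(a - 1) = -a + 1 by ring, ← sub_eq_add_neg a 1]
  ring

/-- The signed count of the walks of length `n` from `x` and its images under the hyperoctahedral
group to the chamber. -/
noncomputable def signedWalkSum (n : ℕ) (x : Fin d → ℤ) : ℚ :=
  laurentPairing chamberSign ((∏ i, oddVar i (x i)) * stepPoly d ^ n)

theorem prod_oddVar_mul_step (x : Fin d → ℤ) (k : Fin d) :
    (∏ i, oddVar i (x i)) * (laurentVar k 1 + laurentVar k (-1)) =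
      ∏ i, oddVar i ((x + Pi.single k 1 : Fin d → ℤ) i) +
        ∏ i, oddVar i ((x - Pi.single k 1 : Fin d → ℤ) i) := by
  have hsplit : ∀ y : Fin d → ℤ, ∏ i, oddVar i (y i) =
      oddVar k (y k) * ∏ i ∈ univ.erase k, oddVar i (y i) := fun y =>
    (mul_prod_erase univ (fun i => oddVar i (y i)) (mem_univ k)).symm
  rw [hsplit, hsplit, hsplit, mul_right_comm, oddVar_mul_step, add_mul]
  congr 2
  · simp
  · exact prod_congr rfl fun i hi => by simp [(mem_erase.1 hi).1]
  · simp
  · exact prod_congr rfl fun i hi => by simp [(mem_erase.1 hi).1]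

theorem signedWalkSum_succ (n : ℕ) (x : Fin d → ℤ) :
    signedWalkSum (n + 1) x =
      ∑ k, (signedWalkSum n (x + Pi.single k 1) + signedWalkSum n (x - Pi.single k 1)) := by
  simp only [signedWalkSum]
  rw [pow_succ', ← mul_assoc, stepPoly, mul_sum, sum_mul, map_sum]
  refine sum_congr rfl fun k _ => ?_
  rw [prod_oddVar_mul_step, add_mul, map_add]

theorem signedWalkSum_of_zero (n : ℕ) (x : Fin d → ℤ) (i : Fin d) (h : x i = 0) :
    signedWalkSum n x = 0 := by
  rw [signedWalkSum, prod_eq_zero (mem_univ i), zero_mul, map_zero]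
  rw [h, oddVar, neg_zero, sub_self]

/-- Exchanging the variables `i` and `j` fixes the Laurent polynomial but negates the pairing. -/
theorem signedWalkSum_of_eq (n : ℕ) (x : Fin d → ℤ) (i j : Fin d) (hij : i ≠ j) (h : x i = x j) :
    signedWalkSum n x = 0 := by
  have key := isAntisymm_chamberSign.pairing_perm (Equiv.swap i j)
    ((∏ i, oddVar i (x i)) * stepPoly d ^ n)
  have hprod : laurentPerm (Equiv.swap i j) (∏ i, oddVar i (x i)) = ∏ i, oddVar i (x i) := by
    rw [map_prod, ← Equiv.prod_comp (Equiv.swap i j) fun i => oddVar i (x i)]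
    refine prod_congr rfl fun k _ => ?_
    rw [laurentPerm_oddVar]
    congr 1
    rcases eq_or_ne k i with rfl | hki
    · rw [Equiv.swap_apply_left, h]
    rcases eq_or_ne k j with rfl | hkj
    · rw [Equiv.swap_apply_right, h]
    · rw [Equiv.swap_apply_of_ne_of_ne hki hkj]
  rw [map_mul, map_pow, laurentPerm_stepPoly, hprod, Equiv.Perm.sign_swap hij] at key
  rw [signedWalkSum]
  push_cast at key
  linarith

/-- In the expansion over choices of signs, only the all-plus exponent lies in the positive orthant.
-/
theorem signedWalkSum_zero {x : Fin d → ℤ} (hx : StrictMono x) (h0 : ∀ i, 0 < x i) :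
    signedWalkSum 0 x = 1 := by
  have e : ∀ i, oddVar i (x i) =
      (1 : ℚ) • laurentVar i (x i) + (-1 : ℚ) • laurentVar i (-x i) := fun i => by
    rw [oddVar, one_smul, neg_one_smul, sub_eq_add_neg]
  rw [signedWalkSum, pow_zero, mul_one, prod_congr rfl fun i _ => e i,
    prod_laurentVar_add (fun _ => 1) (fun _ => -1) x fun i => -x i, map_sum,
    sum_eq_single (univ : Finset (Fin d))]
  · simp [chamberSign_eq_one hx h0]
  · intro t _ ht
    obtain ⟨i, hi⟩ : ∃ i, i ∉ t := by
      by_contra! hcon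
      exact ht (eq_univ_iff_forall.2 hcon)
    rw [map_smul, laurentPairing_mono, chamberSign_eq_zero (i := i), smul_zero]
    rw [piecewise_eq_of_notMem _ _ _ hi]
    exact neg_neg_of_pos (h0 i)
  · exact fun h => absurd (mem_univ _) h

/-- The number of walks in the Weyl chamber by the reflection principle. -/
theorem encard_pathSet_weylChamber (n : ℕ) {x : Fin d → ℤ} (hx : x ∈ weylChamber d) :
    ∃ N : ℕ, (N : ℚ) = signedWalkSum n (x ∘ Fin.rev) ∧
      (pathSet LatticeStep (· ∈ weylChamber d) n x).encard = N := by
  -- The Weyl chamber is decreasing, whereas `chamberSign` is 1 on the increasing one; hence the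
  -- reversal.
  refine encard_pathSet_eq_of_recursion (f := fun n x => signedWalkSum n (x ∘ Fin.rev))
    ?_ ?_ ?_ ?_ n hx
  · intro x hx
    exact signedWalkSum_zero (hx.1.comp Fin.rev_strictAnti) fun i => hx.2 _
  · intro n x
    rw [signedWalkSum_succ, ← Equiv.sum_comp Fin.revPerm]
    have hs : ∀ k : Fin d, (Pi.single (Fin.revPerm k) 1 : Fin d → ℤ) =
        (Pi.single k 1 : Fin d → ℤ) ∘ Fin.rev := fun k => by
      funext i
      simp only [Function.comp_apply, Pi.single_apply, Fin.revPerm_apply, Fin.rev_eq_iff]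
    refine sum_congr rfl fun k _ => ?_
    rw [hs]
    rfl
  · intro n x i j hij h
    refine signedWalkSum_of_eq n _ i.rev j.rev (fun h' => hij (Fin.rev_injective h')) ?_
    simpa using h
  · intro n x i h
    refine signedWalkSum_of_zero n _ i.rev ?_
    simpa using h

end SignedWalkSum

/-! ### Symplectic and ordinary alternants -/

section Determinants

open Polynomial in
theorem chebyshev_S_monic {R : Type*} [CommRing R] [Nontrivial R] (n : ℕ) :
    (Chebyshev.S R n).natDegree = n ∧ (Chebyshev.S R n).Monic := by
  have key : ∀ n : ℕ, ((Chebyshev.S R n).natDegree = n ∧ (Chebyshev.S R n).Monic) ∧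
      (Chebyshev.S R (n + 1)).natDegree = n + 1 ∧ (Chebyshev.S R (n + 1)).Monic := by
    intro n
    induction n with
    | zero => simp [monic_X]
    | succ n ih =>
      obtain ⟨⟨h1, h2⟩, h3, h4⟩ := ih
      refine ⟨by push_cast; exact ⟨h3, h4⟩, ?_⟩
      have hdeg : (X * Chebyshev.S R (n + 1)).natDegree = n + 2 := by
        rw [natDegree_X_mul h4.ne_zero, h3]
      have hS : Chebyshev.S R ((n + 1 : ℕ) + 1) =
          X * Chebyshev.S R (n + 1) - Chebyshev.S R n := by
        rw [← Chebyshev.S_add_two]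
        congr 1
      rw [hS]
      have hlt : (Chebyshev.S R n).natDegree < (X * Chebyshev.S R (n + 1)).natDegree := by
        rw [h1, hdeg]
        omega
      refine ⟨by rw [natDegree_sub_eq_left_of_natDegree_lt hlt, hdeg], ?_⟩
      exact (monic_X.mul h4).sub_of_left (degree_lt_degree hlt)
  exact (key n).1

variable {d : ℕ}

/-- Both sides satisfy the three-term recursion of `oddVar_mul_step`:
$S_n(z+z^{-1})=(z^{n+1}-z^{-n-1})/(z-z^{-1})$. -/
theorem oddVar_eq_chebyshev (i : Fin d) (n : ℕ) :
    oddVar i (n + 1) = (laurentVar i 1 - laurentVar i (-1)) *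
      (Polynomial.Chebyshev.S (Laurent d) n).eval (laurentVar i 1 + laurentVar i (-1)) := by
  have key : ∀ n : ℕ, (oddVar i (n + 1) = oddVar i 1 *
      (Polynomial.Chebyshev.S (Laurent d) n).eval (laurentVar i 1 + laurentVar i (-1))) ∧
      oddVar i (n + 2) = oddVar i 1 * (Polynomial.Chebyshev.S (Laurent d) (n + 1)).eval
        (laurentVar i 1 + laurentVar i (-1)) := by
    intro n
    induction n with
    | zero =>
      simp only [Nat.cast_zero, zero_add, Polynomial.Chebyshev.S_zero, Polynomial.Chebyshev.S_one,
        Polynomial.eval_one, Polynomial.eval_X, mul_one, oddVar_mul_step, true_and]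
      simp [oddVar]
    | succ n ih =>
      refine ⟨?_, ?_⟩
      · have := ih.2
        push_cast
        rw [add_assoc, one_add_one_eq_two]
        exact this
      · have h := oddVar_mul_step i (n + 2)
        rw [show ((n : ℤ) + 2 - 1) = n + 1 by ring, ih.1, ih.2] at h
        push_cast
        rw [show (n : ℤ) + 1 + 2 = n + 2 + 1 by ring, eq_sub_of_add_eq h.symm,
          show (n : ℤ) + 1 + 1 = n + 2 by ring, Polynomial.Chebyshev.S_add_two,
          Polynomial.eval_sub, Polynomial.eval_mul, Polynomial.eval_X]
        ring
  exact (key n).1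

/-- The factor by which the symplectic and the ordinary alternants differ. -/
noncomputable def alternantRatio (d : ℕ) : Laurent d :=
  (∏ i, (1 - laurentVar i (-1))) *
    pairProd univ fun i j => 1 - laurentVar i (-1) * laurentVar j (-1)

/-- As the Chebyshev polynomials are monic, the left side reduces to a Vandermonde determinant in
$z_i+z_i^{-1}$; the right one is a Vandermonde in $z_i$. They are compared by
$z-z^{-1}=(1-z^{-1})(1+z)$ and $z_j+z_j^{-1}-z_i-z_i^{-1}=(z_j-z_i)(1-z_i^{-1}z_j^{-1})$. -/
theorem det_oddVar :
    (Matrix.of fun i j : Fin d => oddVar i (j + 1)).det = alternantRatio d *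
      (Matrix.of fun i j : Fin d => laurentVar i j + laurentVar i (j + 1)).det := by
  have h1 : (Matrix.of fun i j : Fin d => oddVar i (j + 1)).det =
      (∏ i : Fin d, (laurentVar i 1 - laurentVar i (-1))) * ∏ i : Fin d, ∏ j ∈ Ioi i,
        (laurentVar j 1 + laurentVar j (-1) - (laurentVar i 1 + laurentVar i (-1))) := by
    simp only [oddVar_eq_chebyshev]
    refine (Matrix.det_mul_column (fun i : Fin d => laurentVar i 1 - laurentVar i (-1))
      (Matrix.of fun i j : Fin d => (Polynomial.Chebyshev.S (Laurent d) (j : ℕ)).eval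
        (laurentVar i 1 + laurentVar i (-1)))).trans ?_
    rw [← Matrix.det_eval_matrixOfPolynomials_eq_det_vandermonde
      (fun i : Fin d => laurentVar i 1 + laurentVar i (-1))
      (fun j : Fin d => Polynomial.Chebyshev.S (Laurent d) (j : ℕ))
      (fun j => (chebyshev_S_monic _).1) (fun j => (chebyshev_S_monic _).2),
      Matrix.det_vandermonde]
  have h2 : (Matrix.of fun i j : Fin d => laurentVar i j + laurentVar i (j + 1)).det =
      (∏ i : Fin d, (1 + laurentVar i 1)) * ∏ i : Fin d, ∏ j ∈ Ioi i,
        (laurentVar j 1 - laurentVar i 1) := by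
    rw [← Matrix.det_vandermonde, ← Matrix.det_mul_column]
    congr 1
    ext1 i j
    rw [Matrix.of_apply, Matrix.of_apply, Matrix.vandermonde_apply, laurentVar_pow, add_mul,
      one_mul, laurentVar_mul, mul_one, add_comm (1 : ℤ)]
  have hz : ∀ i : Fin d, laurentVar i 1 * laurentVar i (-1) = 1 := fun i => by
    rw [laurentVar_mul, add_neg_cancel, laurentVar_zero]
  rw [h1, h2, alternantRatio, pairProd_univ, mul_mul_mul_comm]
  congr 1
  · rw [← prod_mul_distrib]
    exact prod_congr rfl fun i _ => by linear_combination hz i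
  · rw [← prod_mul_distrib]
    refine prod_congr rfl fun i _ => ?_
    rw [← prod_mul_distrib]
    refine prod_congr rfl fun j _ => ?_
    linear_combination laurentVar i (-1) * hz j - laurentVar j (-1) * hz i

end Determinants

/-! ### Littlewood's identity as an identity of functionals -/

section LittlewoodFunctional

variable {d : ℕ}

/-- The coefficient of a power series at a lattice point. -/
noncomputable def latticeCoeff (x : Fin d → ℤ) (G : MvPowerSeries (Fin d) ℚ) : ℚ :=
  open Classical in
  if ∀ i, 0 ≤ x i then
    MvPowerSeries.coeff (Finsupp.equivFunOnFinite.symm fun i => (x i).toNat) G else 0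

theorem latticeCoeff_add (x : Fin d → ℤ) (G H : MvPowerSeries (Fin d) ℚ) :
    latticeCoeff x (G + H) = latticeCoeff x G + latticeCoeff x H := by
  simp only [latticeCoeff]
  split_ifs <;> simp

theorem latticeCoeff_monomial_mul (x : Fin d → ℤ) (m : Fin d →₀ ℕ) (a : ℚ)
    (G : MvPowerSeries (Fin d) ℚ) :
    latticeCoeff x (MvPowerSeries.monomial m a * G) =
      a * latticeCoeff (fun i => x i - m i) G := by
  classical
  rw [latticeCoeff, latticeCoeff, MvPowerSeries.coeff_monomial_mul]
  by_cases h : ∀ i, 0 ≤ x i - (m i : ℤ)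
  · have hx : ∀ i, 0 ≤ x i := fun i => by have := h i; omega
    rw [if_pos hx, if_pos h, if_pos]
    · congr 3
      ext i
      simp only [Finsupp.tsub_apply, Finsupp.equivFunOnFinite_symm_apply_apply]
      omega
    · intro i
      have := h i
      simp only [Finsupp.equivFunOnFinite_symm_apply_apply]
      omega
  · rw [if_neg h, mul_zero]
    split_ifs with h1 h2
    · refine absurd (fun i => ?_) h
      have := h2 i
      have := h1 i
      simp only [Finsupp.equivFunOnFinite_symm_apply_apply] at *
      omega
    · rfl
    · rfl

theorem aeval_laurentVar_monomial (m : Fin d →₀ ℕ) (a : ℚ) :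
    MvPolynomial.aeval (fun i : Fin d => laurentVar i (-1)) (MvPolynomial.monomial m a) =
      a • laurentMono fun i => -(m i : ℤ) := by
  rw [MvPolynomial.aeval_monomial, Finsupp.prod_fintype _ _ fun i => pow_zero _, Algebra.smul_def,
    ← prod_laurentVar]
  congr 1
  refine prod_congr rfl fun i _ => ?_
  rw [laurentVar_pow, mul_neg_one]

/-- Multiplication by a polynomial in the inverse variables is adjoint to multiplication of the
generating function. -/
theorem laurentPairing_aeval_mul {φ : (Fin d → ℤ) → ℚ} {G : MvPowerSeries (Fin d) ℚ}
    (h : ∀ y, φ y = latticeCoeff y G) (P : MvPolynomial (Fin d) ℚ) (g : Laurent d) :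
    laurentPairing φ (MvPolynomial.aeval (fun i : Fin d => laurentVar i (-1)) P * g) =
      laurentPairing (fun y => latticeCoeff y ((P : MvPowerSeries (Fin d) ℚ) * G)) g := by
  induction g using laurent_induction with
  | hadd g h h1 h2 => rw [mul_add, map_add, map_add, h1, h2]
  | hsmul a g h => rw [mul_smul_comm, map_smul, map_smul, h]
  | hmono x =>
    rw [laurentPairing_mono]
    induction P using MvPolynomial.induction_on' with
    | monomial m a =>
      rw [aeval_laurentVar_monomial, smul_mul_assoc, laurentMono_mul, map_smul,
        laurentPairing_mono, h, MvPolynomial.coe_monomial, latticeCoeff_monomial_mul, smul_eq_mul]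
      congr 2
      funext i
      simp only [Pi.add_apply]
      ring
    | add P Q h1 h2 =>
      rw [map_add, add_mul, map_add, h1, h2, MvPolynomial.coe_add, add_mul, latticeCoeff_add]

/-- The factor `∏ X i` shifts all exponents by one, restricting to strictly positive points without
changing the order sign. -/
theorem chamberSign_eq_latticeCoeff (y : Fin d → ℤ) :
    chamberSign y = latticeCoeff y ((∏ i, MvPowerSeries.X i) * orderSeries univ) := by
  classical
  rw [latticeCoeff, chamberSign, coeff_prod_X_mul]
  by_cases h : ∀ i, 0 < y i
  · have hne : ∀ i ∈ (univ : Finset (Fin d)),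
        (Finsupp.equivFunOnFinite.symm fun i => (y i).toNat : Fin d →₀ ℕ) i ≠ 0 := fun i _ => by
      have := h i
      simp only [Finsupp.equivFunOnFinite_symm_apply_apply]
      omega
    rw [if_pos h, if_pos fun i => (h i).le, if_pos hne, coeff_orderSeries_of_forall (by simp),
      pairProd_cmpSign_sub _ hne]
    rfl
  · rw [if_neg h]
    split_ifs with h1 h2
    · refine absurd (fun i => ?_) h
      have := h2 i (mem_univ i)
      have := h1 i
      simp only [Finsupp.equivFunOnFinite_symm_apply_apply] at *
      omega
    · rfl
    · rfl

/-- The sign of `y` as a permutation of `1, …, d`, or `0`. -/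
noncomputable def alternantCoeff (y : Fin d → ℤ) : ℚ :=
  (Matrix.of fun i j : Fin d => if y i = j + 1 then (1 : ℚ) else 0).det

theorem isAntisymm_alternantCoeff : IsAntisymm (alternantCoeff (d := d)) := fun σ y =>
  Matrix.det_permute σ (Matrix.of fun i j : Fin d => if y i = j + 1 then (1 : ℚ) else 0)

theorem prod_X_pow_eq_monomial (c : Fin d → ℕ) :
    ∏ i, (MvPowerSeries.X i : MvPowerSeries (Fin d) ℚ) ^ c i =
      MvPowerSeries.monomial (Finsupp.equivFunOnFinite.symm c) 1 := by
  rw [MvPowerSeries.monomial_one_eq, Finsupp.prod_fintype _ _ fun i => pow_zero _]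
  rfl

theorem latticeCoeff_alternant (y : Fin d → ℤ) :
    latticeCoeff y ((∏ i, MvPowerSeries.X i) *
      pairProd univ fun i j => (MvPowerSeries.X j - MvPowerSeries.X i)) = alternantCoeff y := by
  classical
  have hdet : (∏ i, MvPowerSeries.X i) *
      (pairProd univ fun i j => (MvPowerSeries.X j - MvPowerSeries.X i)) =
      ∑ σ : Equiv.Perm (Fin d), Equiv.Perm.sign σ • ∏ i,
        (MvPowerSeries.X i : MvPowerSeries (Fin d) ℚ) ^ ((σ i : ℕ) + 1) := by
    rw [pairProd_univ, ← Matrix.det_vandermonde, ← Matrix.det_mul_column, ← Matrix.det_transpose,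
      Matrix.det_apply]
    refine sum_congr rfl fun σ _ => ?_
    congr 1
    refine prod_congr rfl fun i _ => ?_
    rw [Matrix.transpose_apply, Matrix.of_apply, Matrix.vandermonde_apply, pow_succ']
  rw [hdet, alternantCoeff, ← Matrix.det_transpose, Matrix.det_apply, latticeCoeff]
  simp only [Matrix.transpose_apply, Matrix.of_apply]
  split_ifs with h
  · rw [map_sum]
    refine sum_congr rfl fun σ _ => ?_
    rw [Units.smul_def, Units.smul_def, map_zsmul, prod_X_pow_eq_monomial,
      MvPowerSeries.coeff_monomial]
    congr 1
    rw [prod_ite_zero, prod_const_one]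
    congr 1
    rw [eq_iff_iff, Equiv.apply_eq_iff_eq, funext_iff]
    refine forall_congr' fun i => ?_
    have := h i
    simp only [mem_univ, true_imp_iff]
    omega
  · push Not at h
    obtain ⟨i, hi⟩ := h
    refine (sum_eq_zero fun σ _ => ?_).symm
    rw [prod_eq_zero (mem_univ i), smul_zero]
    rw [if_neg]
    omega

/-- Littlewood's identity in terms of functionals on Laurent polynomials. -/
theorem laurentPairing_alternantRatio_mul (g : Laurent d) :
    laurentPairing chamberSign (alternantRatio d * g) = laurentPairing alternantCoeff g := by
  have hD : alternantRatio d = MvPolynomial.aeval (fun i : Fin d => laurentVar i (-1))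
      ((∏ i, (1 - MvPolynomial.X i : MvPolynomial (Fin d) ℚ)) * pairProd univ fun i j =>
        1 - MvPolynomial.X i * MvPolynomial.X j) := by
    rw [map_mul, map_prod, map_pairProd, alternantRatio]
    simp
  -- The ratio is a polynomial in the inverse variables, so it moves onto the generating function of
  -- `chamberSign`, where Littlewood's identity leaves the alternant.
  rw [hD, laurentPairing_aeval_mul chamberSign_eq_latticeCoeff]
  congr 2
  funext y
  have hcoe : ∀ P : MvPolynomial (Fin d) ℚ, (P : MvPowerSeries (Fin d) ℚ) =
    MvPolynomial.coeToMvPowerSeries.ringHom P := fun _ => rfl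
  rw [← latticeCoeff_alternant, hcoe, map_mul, map_prod, map_pairProd, mul_left_comm]
  simp only [map_sub, map_mul, map_one]
  simp only [← hcoe, MvPolynomial.coe_X]
  rw [prod_mul_orderSeries]

end LittlewoodFunctional

/-! ### Bessel series and the determinant -/

section BesselExpansion

variable {d : ℕ}

theorem besselI_neg (s : ℤ) : besselI (-s) = besselI s := by
  ext m
  rw [besselI, besselI, PowerSeries.coeff_mk, PowerSeries.coeff_mk, ← Nat.sum_antidiagonal_swap]
  refine sum_congr rfl fun p _ => ?_
  rw [Prod.fst_swap, Prod.snd_swap, mul_comm (p.1.factorial : ℚ)]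
  congr 1
  rw [eq_iff_iff]
  omega

theorem derivative_besselI (s : ℤ) :
    PowerSeries.derivative ℚ (besselI s) = besselI (s - 1) + besselI (s + 1) := by
  ext m
  rw [PowerSeries.coeff_derivative, map_add, besselI, besselI, besselI, PowerSeries.coeff_mk,
    PowerSeries.coeff_mk, PowerSeries.coeff_mk, sum_mul]
  -- Differentiation brings down `m + 1 = p.1 + p.2`; each summand lowers one of the two factorials,
  -- which moves `s` by one.
  have e : ∀ p ∈ antidiagonal (m + 1),
      (if (p.1 : ℤ) - (p.2 : ℤ) = s then 1 / ((p.1.factorial : ℚ) * (p.2.factorial : ℚ)) else 0) *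
        ((m : ℚ) + 1) =
      (if (p.1 : ℤ) - (p.2 : ℤ) = s then p.1 / ((p.1.factorial : ℚ) * (p.2.factorial : ℚ)) else 0) +
      if (p.1 : ℤ) - (p.2 : ℤ) = s then p.2 / ((p.1.factorial : ℚ) * (p.2.factorial : ℚ)) else 0 := by
    intro p hp
    have h : ((p.1 : ℚ) + p.2) = m + 1 := by exact_mod_cast mem_antidiagonal.1 hp
    split_ifs
    · rw [← h]; ring
    · simp
  rw [sum_congr rfl e, sum_add_distrib, Nat.sum_antidiagonal_succ, Nat.sum_antidiagonal_succ']
  have hf : ∀ a b : ℕ, ((a + 1 : ℕ) : ℚ) / (((a + 1).factorial : ℚ) * b.factorial) =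
      1 / ((a.factorial : ℚ) * b.factorial) := fun a b => by
    rw [Nat.factorial_succ]
    have h1 : ((a + 1 : ℕ) : ℚ) ≠ 0 := Nat.cast_ne_zero.2 a.succ_ne_zero
    push_cast at h1 ⊢
    have := Nat.cast_ne_zero (R := ℚ).2 a.factorial_ne_zero
    have := Nat.cast_ne_zero (R := ℚ).2 b.factorial_ne_zero
    field_simp
  have hf' : ∀ a b : ℕ, ((b + 1 : ℕ) : ℚ) / ((a.factorial : ℚ) * (b + 1).factorial) =
      1 / ((a.factorial : ℚ) * b.factorial) := fun a b => by
    rw [mul_comm, hf, mul_comm]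
  congr 1
  · simp only [Nat.cast_zero, zero_div, ite_self, zero_add, hf]
    refine sum_congr rfl fun p _ => ?_
    congr 1
    rw [eq_iff_iff]
    push_cast
    omega
  · simp only [Nat.cast_zero, zero_div, ite_self, zero_add, hf']
    refine sum_congr rfl fun p _ => ?_
    congr 1
    rw [eq_iff_iff]
    push_cast
    omega

theorem constantCoeff_besselI (s : ℤ) :
    PowerSeries.constantCoeff (besselI s) = if s = 0 then 1 else 0 := by
  rw [← PowerSeries.coeff_zero_eq_constantCoeff_apply, besselI, PowerSeries.coeff_mk]
  simp [eq_comm]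

theorem leibniz_prod {R A ι : Type*} [CommRing R] [CommRing A] [Algebra R A] [DecidableEq ι]
    (D : Derivation R A A) (s : Finset ι) (f : ι → A) :
    D (∏ i ∈ s, f i) = ∑ i ∈ s, D (f i) * ∏ j ∈ s.erase i, f j := by
  induction s using Finset.induction_on with
  | empty => simp
  | insert k s hk ih =>
    rw [prod_insert hk, D.leibniz, ih, sum_insert hk, erase_insert hk, smul_eq_mul, smul_eq_mul,
      mul_sum, add_comm, mul_comm]
    congr 1
    refine sum_congr rfl fun i hi => ?_
    have hki : k ≠ i := fun h => hk (h ▸ hi)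
    rw [erase_insert_of_ne hki, prod_insert fun h => hk (mem_of_mem_erase h)]
    ring

/-- The exponential generating function of the unrestricted lattice walks from `0` to `y`. -/
noncomputable def besselProd (y : Fin d → ℤ) : PowerSeries ℚ := ∏ i, besselI (y i)

theorem derivative_besselProd (y : Fin d → ℤ) :
    PowerSeries.derivative ℚ (besselProd y) =
      ∑ k, (besselProd (y - Pi.single k 1) + besselProd (y + Pi.single k 1)) := by
  have hsplit : ∀ (y : Fin d → ℤ) k, ∏ i, besselI (y i) =
      besselI (y k) * ∏ i ∈ univ.erase k, besselI (y i) := fun y k =>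
    (mul_prod_erase univ (fun i => besselI (y i)) (mem_univ k)).symm
  rw [besselProd, leibniz_prod]
  refine sum_congr rfl fun k _ => ?_
  rw [besselProd, besselProd, hsplit _ k, hsplit _ k, derivative_besselI, add_mul]
  congr 2
  · simp
  · exact prod_congr rfl fun i hi => by simp [(mem_erase.1 hi).1]
  · simp
  · exact prod_congr rfl fun i hi => by simp [(mem_erase.1 hi).1]

/-- Differentiating the product of Bessel series in $t$ obeys the same recursion in `y` as
multiplying by one more step. -/
theorem coeff_stepPoly_pow (n : ℕ) (y : Fin d → ℤ) :
    (stepPoly d ^ n).coeff y = n.factorial * PowerSeries.coeff n (besselProd y) := by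
  induction n generalizing y with
  | zero =>
    rw [pow_zero, ← laurentMono_zero, laurentMono, besselProd,
      PowerSeries.coeff_zero_eq_constantCoeff_apply, map_prod]
    simp only [constantCoeff_besselI, prod_ite_zero, prod_const_one]
    simp [Finsupp.single_apply, funext_iff, eq_comm]
  | succ n ih =>
    have h := congrArg (PowerSeries.coeff n) (derivative_besselProd y)
    rw [PowerSeries.coeff_derivative] at h
    have hs : stepPoly d * stepPoly d ^ n =
        ∑ k, (laurentVar k 1 + laurentVar k (-1)) * stepPoly d ^ n := by
      rw [← sum_mul, stepPoly]
    rw [pow_succ', hs, Nat.factorial_succ, Nat.cast_mul, mul_comm ((n + 1 : ℕ) : ℚ), mul_assoc,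
      mul_comm ((n + 1 : ℕ) : ℚ), Nat.cast_succ, h, map_sum, mul_sum,
      AddMonoidAlgebra.coeff_sum, Finsupp.finsetSum_apply]
    refine sum_congr rfl fun k _ => ?_
    rw [add_mul, map_add, AddMonoidAlgebra.coeff_add, Finsupp.add_apply, laurentVar, laurentVar,
      coeff_mono_mul, coeff_mono_mul, ih, ih, Pi.single_neg, sub_neg_eq_add, mul_add]

theorem coeff_prod_mul_stepPoly_pow (n : ℕ) (a b y : Fin d → ℤ) :
    ((∏ i, (laurentVar i (a i) + laurentVar i (b i))) * stepPoly d ^ n).coeff y =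
      n.factorial * PowerSeries.coeff n (∏ i, (besselI (y i - a i) + besselI (y i - b i))) := by
  have h := prod_laurentVar_add (fun _ => 1) (fun _ => 1) a b
  simp only [one_smul, piecewise_same, prod_const_one] at h
  rw [h, sum_mul, AddMonoidAlgebra.coeff_sum, Finsupp.finsetSum_apply, prod_add, powerset_univ,
    map_sum, mul_sum]
  refine sum_congr rfl fun t _ => ?_
  rw [coeff_mono_mul, coeff_stepPoly_pow, besselProd]
  have h' := prod_piecewise univ t (fun i => besselI (y i - a i)) fun i => besselI (y i - b i)
  rw [univ_inter] at h'
  rw [← h']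
  congr 2
  refine prod_congr rfl fun i _ => ?_
  by_cases hi : i ∈ t <;> simp [hi]

theorem laurentPairing_alternantCoeff (g : Laurent d) :
    laurentPairing alternantCoeff g =
      ∑ σ : Equiv.Perm (Fin d), (Equiv.Perm.sign σ : ℤ) * g.coeff fun i => (σ i : ℤ) + 1 := by
  induction g using laurent_induction with
  | hadd g h h1 h2 => simp [h1, h2, mul_add, sum_add_distrib]
  | hsmul a g h =>
    rw [map_smul, h, smul_eq_mul, mul_sum]
    refine sum_congr rfl fun σ _ => ?_
    simp
    ring
  | hmono y =>
    rw [laurentPairing_mono, alternantCoeff, ← Matrix.det_transpose, Matrix.det_apply']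
    refine sum_congr rfl fun σ _ => ?_
    congr 1
    simp only [Matrix.transpose_apply, Matrix.of_apply, prod_ite_zero, prod_const_one]
    simp [laurentMono, Finsupp.single_apply, funext_iff]

/-- The signed walk sum at `(1, …, d)`. -/
theorem signedWalkSum_eq_coeff_det (d n : ℕ) :
    signedWalkSum n (fun i : Fin d => (i : ℤ) + 1) =
      n.factorial * PowerSeries.coeff n (besselMatrix d).det := by
  have hstep : ∀ σ, laurentPerm σ (stepPoly d ^ n) = stepPoly d ^ n := fun σ => by
    rw [map_pow, laurentPerm_stepPoly]
  have h1 := isAntisymm_chamberSign.pairing_det (Q := fun i j : Fin d => oddVar i (j + 1))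
    (fun σ i j => laurentPerm_oddVar σ i _) hstep
  have h2 := isAntisymm_alternantCoeff.pairing_det
    (Q := fun i j : Fin d => laurentVar i j + laurentVar i (j + 1))
    (fun σ i j => by rw [map_add, laurentPerm_var, laurentPerm_var]) hstep
  -- Both determinants antisymmetrise their diagonal products, so the same factor `d!` appears on
  -- both sides and cancels.
  rw [det_oddVar, mul_assoc, laurentPairing_alternantRatio_mul, h2] at h1
  have h3 := mul_left_cancel₀ (Nat.cast_ne_zero.2 d.factorial_ne_zero) h1
  rw [signedWalkSum, ← h3, laurentPairing_alternantCoeff, ← Matrix.det_transpose,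
    Matrix.det_apply, map_sum, mul_sum]
  refine sum_congr rfl fun σ _ => ?_
  rw [coeff_prod_mul_stepPoly_pow n (fun i : Fin d => (i : ℤ)) fun i => (i : ℤ) + 1,
    Units.smul_def, map_zsmul, zsmul_eq_mul, mul_left_comm]
  congr 3
  refine prod_congr rfl fun i _ => ?_
  -- The coefficient at $\sigma(i)+1$ produces the orders $\sigma(i)-i$ and $\sigma(i)-i+1$;
  -- evenness in the order turns them into those of the matrix.
  rw [Matrix.transpose_apply, besselMatrix, Matrix.of_apply, ← besselI_neg ((i : ℤ) - σ i),
    ← besselI_neg ((i : ℤ) - σ i - 1), add_comm]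
  congr 2 <;> ring

end BesselExpansion

end Osc

theorem mainTheorem3 (d n : ℕ) :
    ∃ N : ℕ,
      (N : ℚ) = (n.factorial : ℚ) * PowerSeries.coeff n (Osc.besselMatrix d).det ∧
      (Osc.palindromicWalks d n).encard = N ∧
      (Osc.palindromicTableaux d n).encard = N ∧
      (Osc.symmetricNoncrossing d n).encard = N ∧
      (Osc.symmetricNonnesting d n).encard = N ∧
      (Osc.boundedTableaux d n).encard = N := by
  obtain ⟨N, hN, hcard⟩ := Osc.encard_pathSet_weylChamber n (x := Osc.weylDelta d)
    ⟨fun i j hij => by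
      have : (i : ℕ) < j := hij
      simp only [Osc.weylDelta]
      omega, fun i => by
      have := i.isLt
      simp only [Osc.weylDelta]
      omega⟩
  have hrev : Osc.weylDelta d ∘ Fin.rev = fun i : Fin d => (i : ℤ) + 1 := by
    funext i
    have := i.isLt
    simp only [Osc.weylDelta, Function.comp_apply, Fin.val_rev]
    omega
  rw [hrev, Osc.signedWalkSum_eq_coeff_det] at hN
  have htab := (Osc.encard_boundedTableaux d n).trans hcard
  have hpal := (Osc.encard_palindromicTableaux d n).trans htab
  exact ⟨N, hN, (Osc.encard_palindromicWalks d n).trans hcard, hpal,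
    (Osc.encard_symmetricNoncrossing d n).trans hpal,
    (Osc.encard_symmetricNonnesting d n).trans hpal, htab⟩
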